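/- Let $R$ be an associative ring with identity and let $D(R)$ be the (unbounded) derived category of the category $\mathrm{Mod}\text{-}R$ of right $R$-modules. For a non-negative integer $n$, a right $R$-module $T$ is called $n$-tilting if: (T1) there is an exact sequence $0\to P_n\to\dots\to P_1\to P_0\to T\to 0$ in $\mathrm{Mod}\text{-}R$ with every $P_i$ projective; (T2) $\mathrm{Ext}^i_R(T,T^{(\alpha)})=0$ for every $i>0$ and every cardinal $\alpha$, where $T^{(\alpha)}$ is the direct sum of $\alpha$ copies of $T$; (T3) there is an exact sequence $0\to R\to T_0\to T_1\to\dots\to T_n\to 0$ in $\mathrm{Mod}\text{-}R$ in which every $T_i$ is a direct summand of a direct sum of copies of $T$. For $E\in D(R)$ let $\mathrm{Susp}(E)$ be the smallest full subcategory of $D(R)$ (closed under isomorphisms) that contains $E$ and is closed under extensions, positive shifts and set-indexed direct sums. A t-structure $\mathcal{S}=(\mathcal{S}^{\le 0},\mathcal{S}^{\ge 0})$ on $D(R)$ is said to be generated by $E$ if its aisle is $\mathcal{S}^{\le 0}=\mathrm{Susp}(E)$; its co-aisle is $\mathcal{S}^{\ge 0}$. Let $\mathcal{D}=(\mathcal{D}^{\le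 0},\mathcal{D}^{\ge 0})$ be the natural t-structure on $D(R)$, so that $\mathcal{D}^{\ge i}$ consists of the complexes with zero cohomology in all degrees less than $i$. **Proposition.** Let $T$ be an $n$-tilting right $R$-module. Then $T$ generates a t-structure $\mathcal{T}=(\mathcal{T}^{\le 0},\mathcal{T}^{\ge 0})$ on $D(R)$, and the pair $(\mathcal{D},\mathcal{T})$ is right filterable, that is, for every $i\in\mathbb{Z}$ the intersection $\mathcal{D}^{\ge i}\cap\mathcal{T}^{\ge 0}$ is the co-aisle of a t-structure on $D(R)$. More precisely, for every $i\in\mathbb{Z}$ the object $R[-i]\oplus T$ generates a t-structure on $D(R)$, and the co-aisle of that t-structure is $\mathcal{D}^{\ge i}\cap\mathcal{T}^{\ge 0}$. -/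

import Mathlib

open CategoryTheory Limits Pretriangulated Triangulated

universe w v u

noncomputable section

namespace TiltingTStructure

/-! ### Suspended subcategories and generated t-structures -/

section Triangulated

variable {C : Type u} [Category.{v} C] [Preadditive C] [HasZeroObject C] [HasShift C ℤ]
  [∀ n : ℤ, (shiftFunctor C n).Additive] [Pretriangulated C]

/-- A (strictly full) subcategory is suspended if it is closed under extensions and
positive shifts. -/
structure IsSuspended (S : ObjectProperty C) : Prop where
  of_iso : ∀ ⦃X Y : C⦄, (X ≅ Y) → S X → S Y
  extension : ∀ Δ : Triangle C, Δ ∈ distTriang C → S Δ.obj₁ → S Δ.obj₃ → S Δ.obj₂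
  shift : ∀ (X : C) (k : ℤ), 0 ≤ k → S X → S (X⟦k⟧)

/-- Closure under all coproducts that are indexed by types in the universe `w` and
exist in `C`. -/
def IsClosedUnderCoproducts (S : ObjectProperty C) : Prop :=
  ∀ (J : Type w) (X : J → C) (c : Cofan X), IsColimit c → (∀ j, S (X j)) → S c.pt

/-- `susp.{w} E` is the smallest suspended subcategory of `C` which is closed under coproducts
indexed by types in the universe `w` and contains `E`. -/
def susp (E : C) : ObjectProperty C := fun X =>
  ∀ S : ObjectProperty C, IsSuspended S → IsClosedUnderCoproducts.{w} S → S E → S X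

/-- The t-structure `t` is generated by `E`: its aisle is `susp E`. -/
def IsGeneratedBy (t : TStructure C) (E : C) : Prop :=
  t.le 0 = susp.{w} E

/-- A full subcategory is a co-aisle if it is the class `𝒮^{≥ 0}` of some t-structure `𝒮`. -/
def IsCoaisle (S : ObjectProperty C) : Prop :=
  ∃ 𝒮 : TStructure C, 𝒮.ge 0 = S

/-- The pair `(𝒟, 𝒯)` of t-structures is right filterable. -/
def IsRightFilterable (𝒟 𝒯 : TStructure C) : Prop :=
  ∀ i : ℤ, IsCoaisle (𝒟.ge i ⊓ 𝒯.ge 0)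

end Triangulated

/-! ### Tilting modules -/

section Modules

variable (R : Type u) [Ring R]

/-- The category of right `R`-modules. -/
abbrev RMod : Type (u + 1) := ModuleCat.{u} Rᵐᵒᵖ

/-- The regular right `R`-module. -/
abbrev regular : RMod R := ModuleCat.of Rᵐᵒᵖ R

variable {R}

/-- The direct sum of copies of `T` indexed by `α`. -/
abbrev copower (T : RMod R) (α : Type u) : RMod R := ModuleCat.of Rᵐᵒᵖ (α →₀ T)

/-- `M` is a direct summand of a direct sum of copies of `T`. -/
def IsSummandOfCopower (T M : RMod R) : Prop :=
  ∃ α : Type u, Nonempty (Retract M (copower T α))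

/-- The right `R`-module `T` is (not necessarily classical) `n`-tilting. -/
structure IsTilting (n : ℕ) (T : RMod R) : Prop where
  /-- There is an exact sequence `0 → Pₙ → ⋯ → P₀ → T → 0` with all `Pᵢ` projective. -/
  projective_resolution :
    ∃ P : ProjectiveResolution T, ∀ i, n < i → IsZero (P.complex.X i)
  /-- `Extⁱ(T, T^(α)) = 0` for all `i > 0` and all `α`. -/
  ext_copower : ∀ (i : ℕ), 0 < i → ∀ α : Type u, Subsingleton (Abelian.Ext T (copower T α) i)
  /-- There is an exact sequence `0 → R → T₀ → ⋯ → Tₙ → 0` with each `Tᵢ` a direct summand of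
  a direct sum of copies of `T`; as for projective resolutions, it is encoded by a
  quasi-isomorphism from `R`, placed in degree `0`, to the complex `T₀ → ⋯ → Tₙ → 0 → ⋯`. -/
  coresolution :
    ∃ (K : CochainComplex (RMod R) ℕ) (ε : (CochainComplex.single₀ (RMod R)).obj (regular R) ⟶ K),
      QuasiIso ε ∧ (∀ i, i ≤ n → IsSummandOfCopower T (K.X i)) ∧ ∀ i, n < i → IsZero (K.X i)

/-- A module, viewed in the derived category as a complex concentrated in degree `0`. -/
abbrev stalk [HasDerivedCategory.{w} (RMod R)] (M : RMod R) : DerivedCategory (RMod R) :=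
  (DerivedCategory.singleFunctor (RMod R) 0).obj M

end Modules

end TiltingTStructure

end

-- Fix Y in D(R). The objects X with Hom(X[k], Y) = 0 for all k ≥ 0 form a suspended class closed
-- under coproducts, so Y is right orthogonal to Susp(E) as soon as Hom(E[k], Y) = 0 for all k ≥ 0
-- (`rightOrthogonal_susp_iff`). Hence the co-aisle defined by R[-i] ⊕ T is the intersection of
-- those defined by R[-i] and by T. The former is 𝒟^{≥ i}, because R[-i] builds all of 𝒟^{≤ i}
-- (`shiftedOrthogonal_regular_iff`). What remains is the existence of the t-structures.
--
-- For a module M, the class S = Susp(R[-i] ⊕ M) lies between 𝒟^{≤ i} and 𝒟^{≤ max(i, 0)}. Since the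
-- two bounds differ by finitely many degrees, dimension shifting shows that S is closed under
-- filtered colimits of complexes (`IsSuspended.Q_filteredColimit`). Monomorphisms of complexes with
-- cokernel in S (up to a shift) are then stable under pushouts, coproducts and transfinite
-- composition. The small object argument for the inclusions G → cone(id_G), where G runs through
-- K-projective models of the nonnegative shifts of R[-i] and M, embeds any complex, with such a
-- cokernel, into one that receives only zero maps from the generators in D(R)
-- (`exists_shortExact_orthogonal`). This is the truncation triangle.
--
-- Finally, the coresolution of R by summands of copowers of T gives R[n] ∈ Susp(T), so Susp(T) =
-- Susp(R[n] ⊕ T), which is the case i = -n (`susp_eq_of_isTilting`).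

universe t

noncomputable section

namespace TiltingTStructure

/-! ### Suspended classes: retracts and orthogonals -/

section Suspended

variable {C : Type u} [Category.{v} C] [Preadditive C] [HasZeroObject C] [HasShift C ℤ]
  [∀ n : ℤ, (shiftFunctor C n).Additive] [Pretriangulated C]

lemma isSuspended_susp (E : C) : IsSuspended (susp.{w} E) where
  of_iso _ _ e hX S h₁ h₂ h₃ := h₁.of_iso e (hX S h₁ h₂ h₃)
  extension Δ hΔ hX hY S h₁ h₂ h₃ := h₁.extension Δ hΔ (hX S h₁ h₂ h₃) (hY S h₁ h₂ h₃)
  shift X k hk hX S h₁ h₂ h₃ := h₁.shift X k hk (hX S h₁ h₂ h₃)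

lemma isClosedUnderCoproducts_susp (E : C) : IsClosedUnderCoproducts.{w} (susp.{w} E) :=
  fun J X c hc hX S h₁ h₂ h₃ => h₂ J X c hc (fun j => hX j S h₁ h₂ h₃)

lemma susp_self (E : C) : susp.{w} E E := fun _ _ _ h => h

lemma susp_le {E : C} {S : ObjectProperty C} (h₁ : IsSuspended S)
    (h₂ : IsClosedUnderCoproducts.{w} S) (h₃ : S E) : susp.{w} E ≤ S :=
  fun _ hX => hX S h₁ h₂ h₃

lemma IsSuspended.isClosedUnderIsomorphisms {S : ObjectProperty C} (hS : IsSuspended S) :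
    S.IsClosedUnderIsomorphisms :=
  ⟨fun e hX => hS.of_iso e hX⟩

lemma IsSuspended.cone {S : ObjectProperty C} (hS : IsSuspended S) (Δ : Triangle C)
    (hΔ : Δ ∈ distTriang C) (h₁ : S Δ.obj₁) (h₂ : S Δ.obj₂) : S Δ.obj₃ :=
  hS.extension _ (rot_of_distTriang _ hΔ) h₂ (hS.shift _ 1 (by simp) h₁)

lemma IsSuspended.shiftProperty {S : ObjectProperty C} (hS : IsSuspended S) (a : ℤ) :
    IsSuspended (S.shift a) where
  of_iso _ _ e hX := hS.of_iso ((shiftFunctor C a).mapIso e) hX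
  extension _ hΔ h₁ h₃ := hS.extension _ (Triangle.shift_distinguished _ hΔ a) h₁ h₃
  shift X k hk hX := hS.of_iso (shiftComm X a k) (hS.shift _ k hk hX)

lemma IsClosedUnderCoproducts.shiftProperty {S : ObjectProperty C}
    (hS : IsClosedUnderCoproducts.{w} S) (a : ℤ) :
    IsClosedUnderCoproducts.{w} (S.shift a) := fun J X c hc hX =>
  hS J (fun j => (X j)⟦a⟧) _ (isColimitCofanMkObjOfIsColimit (shiftFunctor C a) X (fun j => c.inj j)
    (IsColimit.ofIsoColimit hc (Cofan.ext (Iso.refl c.pt) (fun j => by simp)))) hX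

lemma retract_aux {X E Z : C} (r : Retract X E) (f g : E ⟶ Z) :
    (r.r ≫ r.i) ≫ ((r.r ≫ r.i) ≫ f + (𝟙 E - r.r ≫ r.i) ≫ g) = (r.r ≫ r.i) ≫ f ∧
    (𝟙 E - r.r ≫ r.i) ≫ ((r.r ≫ r.i) ≫ f + (𝟙 E - r.r ≫ r.i) ≫ g) =
      (𝟙 E - r.r ≫ r.i) ≫ g := by
  constructor <;> simp [Preadditive.sub_comp]

/-- The inclusions which exhibit `∐ E ⊞ X` as a coproduct of copies of `E` when `X` is a retract
of `E`. -/
def swindleInj {X E : C} (r : Retract X E) {W : C} (ι : ℕ → (E ⟶ W)) : ℕ → (E ⟶ W ⊞ X)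
  | 0 => r.r ≫ biprod.inr + (𝟙 E - r.r ≫ r.i) ≫ ι 0 ≫ biprod.inl
  | k + 1 => (r.r ≫ r.i) ≫ ι k ≫ biprod.inl + (𝟙 E - r.r ≫ r.i) ≫ ι (k + 1) ≫ biprod.inl

/-- Eilenberg swindle: the X-part of each copy of E moves one place down, that of copy 0 landing in
the extra summand X, while the complementary parts stay in place. Only the idempotent `r.r ≫ r.i` is
used, so X need not have a complement in E. -/
lemma inl_eq_swindleInj {X E : C} (r : Retract X E) {W : C} (ι : ℕ → (E ⟶ W)) (k : ℕ) :
    ι k ≫ (biprod.inl : W ⟶ W ⊞ X) =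
      (r.r ≫ r.i) ≫ swindleInj r ι (k + 1) + (𝟙 E - r.r ≫ r.i) ≫ swindleInj r ι k := by
  rw [swindleInj, (retract_aux r _ _).1]
  cases k with
  | zero => simp [swindleInj, Preadditive.sub_comp]
  | succ k => rw [swindleInj, (retract_aux r _ _).2]; simp [Preadditive.sub_comp]

lemma inr_eq_swindleInj {X E : C} (r : Retract X E) {W : C} (ι : ℕ → (E ⟶ W)) :
    (biprod.inr : X ⟶ W ⊞ X) = r.i ≫ swindleInj r ι 0 := by
  simp [swindleInj, Preadditive.sub_comp]

/-- If `X` is a retract of `E`, then `∐ E ⊞ X` is a coproduct of copies of `E`. -/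
def isColimitSwindle {X E : C} (r : Retract X E) [HasCoproductsOfShape (ULift.{w} ℕ) C] :
    IsColimit (Cofan.mk (∐ (fun _ : ULift.{w} ℕ => E) ⊞ X) (fun k : ULift.{w} ℕ => swindleInj r
      (fun k => Sigma.ι (fun _ : ULift.{w} ℕ => E) ⟨k⟩) k.down)) :=
  Cofan.IsColimit.mk _ (fun s => biprod.desc (Sigma.desc (fun k =>
      (r.r ≫ r.i) ≫ s.inj ⟨k.down + 1⟩ + (𝟙 E - r.r ≫ r.i) ≫ s.inj k)) (r.i ≫ s.inj ⟨0⟩))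
    (by
      rintro s ⟨_ | k⟩
      · simp [swindleInj, Preadditive.sub_comp]
      · simp [swindleInj, Preadditive.sub_comp])
    (by
      intro s m hm
      replace hm (k : ℕ) : swindleInj r (fun k => Sigma.ι (fun _ : ULift.{w} ℕ => E) ⟨k⟩) k ≫ m =
        s.inj ⟨k⟩ := hm ⟨k⟩
      apply biprod.hom_ext'
      · apply Sigma.hom_ext
        rintro ⟨k⟩
        have := inl_eq_swindleInj r (fun k => Sigma.ι (fun _ : ULift.{w} ℕ => E) ⟨k⟩) k =≫ m
        rw [Category.assoc] at this
        rw [this, Preadditive.add_comp, Category.assoc, hm, Category.assoc _ _ m, hm]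
        simp
      · rw [inr_eq_swindleInj r (fun k => Sigma.ι (fun _ : ULift.{w} ℕ => E) ⟨k⟩),
          Category.assoc, hm, ← inr_eq_swindleInj]
        simp)

/-- With W a countable coproduct of copies of E, the object X is the cone of W → W ⊞ X, and by the
swindle both of these are coproducts of copies of E. -/
lemma IsSuspended.retract {S : ObjectProperty C} (hS : IsSuspended S)
    (hS' : IsClosedUnderCoproducts.{w} S) [HasCoproductsOfShape (ULift.{w} ℕ) C]
    {X E : C} (r : Retract X E) (hE : S E) : S X :=
  hS.cone _ (binaryBiproductTriangle_distinguished (∐ (fun _ : ULift.{w} ℕ => E)) X)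
    (hS' _ _ _ (coproductIsCoproduct _) (fun _ => hE))
    (hS' _ _ _ (isColimitSwindle.{w} r) (fun _ => hE))

/-- The objects `X` such that all morphisms from a nonnegative shift of `X` to `Y` vanish. -/
def shiftedOrthogonal (Y : C) : ObjectProperty C :=
  fun X => ∀ (k : ℤ), 0 ≤ k → ∀ f : X⟦k⟧ ⟶ Y, f = 0

lemma isSuspended_shiftedOrthogonal (Y : C) : IsSuspended (shiftedOrthogonal Y) where
  of_iso X X' e hX k hk f := by
    rw [← cancel_epi (e.hom⟦k⟧'), comp_zero]
    exact hX k hk _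
  extension Δ hΔ h₁ h₃ k hk f := by
    obtain ⟨g, hg⟩ := Triangle.yoneda_exact₂ _ (Triangle.shift_distinguished _ hΔ k) f
      (h₁ k hk _)
    rw [hg, show g = 0 from h₃ k hk g]
    exact comp_zero
  shift X a ha hX k hk f := by
    rw [← cancel_epi ((shiftFunctorAdd C a k).hom.app X), comp_zero]
    exact hX (a + k) (by lia) _

lemma isClosedUnderCoproducts_shiftedOrthogonal (Y : C) :
    IsClosedUnderCoproducts.{w} (shiftedOrthogonal Y) := fun J X c hc hX k hk f => by
  have := isColimitCofanMkObjOfIsColimit (shiftFunctor C k) X (fun j => c.inj j)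
    (IsColimit.ofIsoColimit hc (Cofan.ext (Iso.refl c.pt) (fun j => by simp)))
  refine Cofan.IsColimit.hom_ext this _ _ (fun j => ?_)
  rw [comp_zero]
  exact hX j k hk _

lemma rightOrthogonal_susp_iff (E Y : C) :
    (susp.{w} E).rightOrthogonal Y ↔ ∀ (k : ℤ), 0 ≤ k → ∀ f : E⟦k⟧ ⟶ Y, f = 0 := by
  constructor
  · intro h k hk f
    exact h f ((isSuspended_susp E).shift _ k hk (susp_self E))
  · intro h X f hX
    have : shiftedOrthogonal Y X := susp_le (isSuspended_shiftedOrthogonal Y)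
      (isClosedUnderCoproducts_shiftedOrthogonal.{w} Y) h X hX
    rw [← cancel_epi ((shiftFunctorZero C ℤ).hom.app X), comp_zero]
    exact this 0 le_rfl _

end Suspended

/-! ### Exact colimits of complexes preserve quasi-isomorphisms -/

section ExactColimits

variable {A : Type*} [Category* A] [Abelian A] {ι : Type*} {c : ComplexShape ι}
  {J : Type*} [Category* J]

/-- The complex of functors attached to a diagram of complexes. -/
@[simps]
def complexOfDiagram (F : J ⥤ HomologicalComplex A c) : HomologicalComplex (J ⥤ A) c where
  X i := F ⋙ HomologicalComplex.eval A c i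
  d i j := { app := fun k => (F.obj k).d i j, naturality := fun _ _ f => (F.map f).comm i j }
  shape i j h := by ext k; exact (F.obj k).shape i j h
  d_comp_d' i j l _ _ := by ext k; exact (F.obj k).d_comp_d i j l

/-- The morphism between complexes of functors attached to a morphism of diagrams. -/
@[simps]
def complexOfDiagramMap {F G : J ⥤ HomologicalComplex A c} (α : F ⟶ G) :
    complexOfDiagram F ⟶ complexOfDiagram G where
  f i := Functor.whiskerRight α (HomologicalComplex.eval A c i)
  comm' i j _ := by ext k; exact (α.app k).comm i j

/-- A diagram of complexes is a complex in the abelian category of diagrams, where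
quasi-isomorphisms are detected objectwise; the exact functor `colim` preserves them. -/
lemma quasiIsoAt_of_isColimit [HasColimitsOfShape J A] [HasExactColimitsOfShape J A]
    {F G : J ⥤ HomologicalComplex A c} {cF : Cocone F} {cG : Cocone G}
    (hF : IsColimit cF) (hG : IsColimit cG) (α : F ⟶ G) (φ : cF.pt ⟶ cG.pt)
    (hφ : ∀ j, cF.ι.app j ≫ φ = α.app j ≫ cG.ι.app j) (i : ι)
    (hα : ∀ j, QuasiIsoAt (α.app j) i) : QuasiIsoAt φ i := by
  let hF' := HomologicalComplex.isColimitCoconeOfHasColimitEval F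
  let hG' := HomologicalComplex.isColimitCoconeOfHasColimitEval G
  have h₁ : QuasiIsoAt (complexOfDiagramMap α) i := by
    rw [HomologicalComplex.quasiIsoAt_iff_evaluation]
    exact hα
  have h₂ : QuasiIsoAt ((colim.mapHomologicalComplex c).map (complexOfDiagramMap α)) i :=
    inferInstance
  let e₁ := hF.coconePointUniqueUpToIso hF'
  let e₂ := hG.coconePointUniqueUpToIso hG'
  let ψ : (HomologicalComplex.coconeOfHasColimitEval F).pt ⟶
    (HomologicalComplex.coconeOfHasColimitEval G).pt :=
      (colim.mapHomologicalComplex c).map (complexOfDiagramMap α)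
  have h₃ : QuasiIsoAt ψ i := h₂
  have fac : φ = e₁.hom ≫ ψ ≫ e₂.inv := by
    apply hF.hom_ext
    intro j
    rw [hφ, ← Category.assoc, IsColimit.comp_coconePointUniqueUpToIso_hom,
      ← IsColimit.comp_coconePointUniqueUpToIso_inv hG hG' j, ← Category.assoc, ← Category.assoc]
    congr 1
    ext i
    dsimp [ψ]
    exact (ι_colimMap ((complexOfDiagramMap α).f i) j).symm
  rw [fac]
  infer_instance

instance quasiIso_isStableUnderColimitsOfShape [HasColimitsOfShape J A]
    [HasExactColimitsOfShape J A] :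
    (HomologicalComplex.quasiIso A c).IsStableUnderColimitsOfShape J where
  condition _ _ _ _ h₁ h₂ α hα φ hφ := by
    rw [HomologicalComplex.mem_quasiIso_iff, quasiIso_iff]
    exact fun i => quasiIsoAt_of_isColimit h₁ h₂ α φ hφ i
      (fun j => by have : QuasiIso (α.app j) := hα j; infer_instance)

lemma exactAt_of_isColimit [HasColimitsOfShape J A] [HasExactColimitsOfShape J A]
    {F : J ⥤ HomologicalComplex A c} {cF : Cocone F} (hF : IsColimit cF) (i : ι)
    (h : ∀ j, (F.obj j).ExactAt i) : cF.pt.ExactAt i := by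
  -- Exactness in degree i means that the zero endomorphism is a quasi-isomorphism there, which
  -- reduces the claim to the previous lemma.
  have : QuasiIsoAt (0 : cF.pt ⟶ cF.pt) i :=
    quasiIsoAt_of_isColimit hF hF 0 0 (by simp) i (fun j => by
      rw [quasiIsoAt_iff_exactAt _ _ (h j)]
      exact h j)
  rw [HomologicalComplex.exactAt_iff_isZero_homology, IsZero.iff_id_eq_zero,
    ← cancel_mono (HomologicalComplex.homologyMap (0 : cF.pt ⟶ cF.pt) i)]
  simp

end ExactColimits

/-! ### Coproducts in the derived category -/

section Coproducts

variable {A : Type u} [Category.{v} A] [Abelian A] [HasDerivedCategory.{t} A]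

open DerivedCategory

lemma isZero_Q_obj_iff (K : CochainComplex A ℤ) : IsZero (Q.obj K) ↔ K.Acyclic := by
  have h : QuasiIso (0 : K ⟶ K) ↔ K.Acyclic := by
    rw [quasiIso_iff]
    refine ⟨fun h i => ?_, fun h i => (quasiIsoAt_iff_exactAt _ _ (h i)).2 (h i)⟩
    rw [HomologicalComplex.exactAt_iff_isZero_homology, IsZero.iff_id_eq_zero,
      ← cancel_mono (HomologicalComplex.homologyMap (0 : K ⟶ K) i)]
    simp
  rw [← h, ← isIso_Q_map_iff_quasiIso, Functor.map_zero]
  refine ⟨fun h => ⟨0, h.eq_of_src _ _, h.eq_of_src _ _⟩, fun h => ?_⟩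
  rw [IsZero.iff_id_eq_zero, ← cancel_mono (0 : Q.obj K ⟶ Q.obj K)]
  simp

lemma acyclic_mappingCone_id (K : CochainComplex A ℤ) :
    (CochainComplex.mappingCone (𝟙 K)).Acyclic := by
  rw [← isZero_Q_obj_iff, IsZero.iff_id_eq_zero, ← CategoryTheory.Functor.map_id,
    Q_map_eq_of_homotopy A (CochainComplex.mappingCone.homotopyToZeroOfId K), Functor.map_zero]

/-- After composition with a quasi-isomorphism such a map becomes null-homotopic, hence extends over
the cone of an identity. Both data, a quasi-isomorphism and an acyclic complex, survive coproducts.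
-/
lemma exists_comp_eq_of_Q_map_eq_zero {K L : CochainComplex A ℤ} (h : K ⟶ L)
    (h₀ : Q.map h = 0) :
    ∃ (K' N : CochainComplex A ℤ) (s : K' ⟶ K) (_ : QuasiIso s) (a : K' ⟶ N) (b : N ⟶ L),
      N.Acyclic ∧ s ≫ h = a ≫ b := by
  have h₁ : Qh.map ((HomotopyCategory.quotient _ _).map h) = Qh.map 0 := by
    rw [← cancel_mono ((quotientCompQhIso A).hom.app L), quotientCompQhIso_hom_naturality, h₀]
    simp
  rw [MorphismProperty.map_eq_iff_precomp Qh (HomotopyCategory.quasiIso A _)] at h₁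
  obtain ⟨K', s, hs, eq⟩ := h₁
  obtain ⟨K', rfl⟩ := HomotopyCategory.quotient_obj_surjective K'
  obtain ⟨s, rfl⟩ := (HomotopyCategory.quotient _ _).map_surjective s
  rw [comp_zero, ← Functor.map_comp] at eq
  have e : Homotopy (s ≫ h) 0 := HomotopyCategory.homotopyOfEq _ _ (by rw [eq, Functor.map_zero])
  refine ⟨K', CochainComplex.mappingCone (𝟙 K'), s, ?_, CochainComplex.mappingCone.inr _,
    CochainComplex.mappingCone.desc _ (CochainComplex.HomComplex.Cochain.ofHomotopy e)
      (s ≫ h) (by simp), acyclic_mappingCone_id _, by simp⟩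
  rwa [HomotopyCategory.quotient_map_mem_quasiIso_iff] at hs

variable {J : Type*} [HasCoproductsOfShape J A] [HasExactColimitsOfShape (Discrete J) A]

lemma quasiIso_sigmaMap {X Y : J → CochainComplex A ℤ} (s : ∀ j, X j ⟶ Y j)
    (hs : ∀ j, QuasiIso (s j)) : QuasiIso (Limits.Sigma.map s) :=
  MorphismProperty.colimMap (W := HomologicalComplex.quasiIso A (.up ℤ))
    (Discrete.natTrans (fun j => s j.as) : Discrete.functor X ⟶ Discrete.functor Y)
    (fun j => hs j.as)

lemma acyclic_sigma {X : J → CochainComplex A ℤ} (hX : ∀ j, (X j).Acyclic) :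
    (∐ X).Acyclic :=
  fun i => exactAt_of_isColimit (colimit.isColimit _) i (fun j => hX j.as i)

/-- Write f as a left fraction. The factorizations through acyclic complexes that kill its
restrictions to the summands add up to one over the whole coproduct. -/
lemma Q_map_sigma_hom_ext {X : J → CochainComplex A ℤ} {Z : DerivedCategory A}
    {f : Q.obj (∐ X) ⟶ Z} (hf : ∀ j, Q.map (Sigma.ι X j) ≫ f = 0) : f = 0 := by
  obtain ⟨Y, g, s, hs, hfac⟩ := left_fac (f ≫ (Q.objObjPreimageIso Z).inv)
  have hg (j : J) : Q.map (Sigma.ι X j ≫ g) = 0 := by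
    have := hf j =≫ ((Q.objObjPreimageIso Z).inv ≫ Q.map s)
    rw [Category.assoc, ← Category.assoc f, hfac] at this
    simpa using this
  choose X' N σ hσ a b hN fac using fun j => exists_comp_eq_of_Q_map_eq_zero _ (hg j)
  have := quasiIso_sigmaMap σ hσ
  have hg : Q.map g = 0 := by
    have eq : Limits.Sigma.map σ ≫ g = Limits.Sigma.map a ≫ Limits.Sigma.desc b := by
      apply Sigma.hom_ext
      intro j
      simp [fac]
    rw [← cancel_epi (Q.map (Limits.Sigma.map σ)), ← Functor.map_comp, eq, Functor.map_comp, comp_zero,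
      ((isZero_Q_obj_iff _).2 (acyclic_sigma hN)).eq_of_src (Q.map (Limits.Sigma.desc b)) 0, comp_zero]
  rw [← cancel_mono (Q.objObjPreimageIso Z).inv, hfac, hg]
  simp

/-- The right fractions that represent the given maps can be summed, because a coproduct of their
denominators is again a quasi-isomorphism. -/
lemma exists_desc_Q_sigma {X : J → CochainComplex A ℤ} {Z : DerivedCategory A}
    (g : ∀ j, Q.obj (X j) ⟶ Z) :
    ∃ f : Q.obj (∐ X) ⟶ Z, ∀ j, Q.map (Sigma.ι X j) ≫ f = g j := by
  choose X' s hs g' fac using fun j => right_fac (g j ≫ (Q.objObjPreimageIso Z).inv)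
  simp only [isIso_Q_map_iff_quasiIso] at hs
  have := quasiIso_sigmaMap s hs
  refine ⟨inv (Q.map (Limits.Sigma.map s)) ≫ Q.map (Limits.Sigma.desc g') ≫
    (Q.objObjPreimageIso Z).hom, fun j => ?_⟩
  rw [← cancel_mono (Q.objObjPreimageIso Z).inv, fac, IsIso.eq_inv_comp]
  simp only [Category.assoc, Iso.hom_inv_id, Category.comp_id]
  rw [← Category.assoc, ← Functor.map_comp, ← Sigma.ι_map, Functor.map_comp, Category.assoc,
    IsIso.hom_inv_id_assoc, ← Functor.map_comp, Sigma.ι_desc]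

variable (J) in
/-- The localization functor to the derived category preserves the coproducts which are exact. -/
instance preservesCoproducts_Q : PreservesColimitsOfShape (Discrete J) (Q (C := A)) :=
  have (X : J → CochainComplex A ℤ) : PreservesColimit (Discrete.functor X) (Q (C := A)) :=
    preservesColimit_of_preserves_colimit_cocone
      (coproductIsCoproduct X) ((isColimitMapCoconeCofanMkEquiv _ _ _).symm
        (Cofan.IsColimit.mk _ (fun s => (exists_desc_Q_sigma s.inj).choose)
          (fun s => (exists_desc_Q_sigma s.inj).choose_spec)
          (fun s m hm => by
            rw [← sub_eq_zero]
            apply Q_map_sigma_hom_ext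
            intro j
            rw [Preadditive.comp_sub, (exists_desc_Q_sigma s.inj).choose_spec, sub_eq_zero]
            exact hm j)))
  preservesColimitsOfShape_of_discrete _

variable (A J) in
lemma derivedCategory_hasCoproductsOfShape : HasCoproductsOfShape J (DerivedCategory A) where
  has_colimit F := by
    let G : Discrete J ⥤ CochainComplex A ℤ := Discrete.functor (fun j => Q.objPreimage (F.obj ⟨j⟩))
    have : HasColimit (G ⋙ Q) := ⟨⟨_, isColimitOfPreserves Q (colimit.isColimit G)⟩⟩
    exact hasColimit_of_iso (Discrete.natIso (fun j => Q.objObjPreimageIso (F.obj j)) :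
      G ⋙ Q ≅ F).symm

end Coproducts

/-! ### The telescope of a sequence -/

section Telescope

variable {B : Type u} [Category.{v} B] [Abelian B]

lemma eq_zero_of_comp_sigmaπ {α : Type*} [Finite α] [DecidableEq α] {f : α → B} {Z : B} {g : Z ⟶ ∐ f}
    (hg : ∀ b, g ≫ Limits.Sigma.π f b = 0) : g = 0 := by
  have := Fintype.ofFinite α
  have h : 𝟙 (∐ f) = ∑ b, Limits.Sigma.π f b ≫ Sigma.ι f b := by
    apply Sigma.hom_ext
    intro s
    rw [Preadditive.comp_sum, Finset.sum_eq_single s]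
    · simp
    · intro b _ hb
      rw [← Category.assoc, Limits.Sigma.ι_π_of_ne _ hb.symm, zero_comp]
    · simp
  rw [← Category.comp_id g, h, Preadditive.comp_sum]
  refine Finset.sum_eq_zero (fun b _ => ?_)
  rw [← Category.assoc, hg, zero_comp]

variable [IsGrothendieckAbelian.{w} B]

-- The map is a filtered colimit of its restrictions to finite subcoproducts, which are
-- monomorphisms; filtered colimits are exact in a Grothendieck category.
open CoproductsFromFiniteFiltered in
lemma mono_piLift_sigmaπ {α : Type w} [DecidableEq α] (f : α → B) : Mono (Pi.lift (Limits.Sigma.π f)) := by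
  classical
  refine (inferInstance : (MorphismProperty.monomorphisms B).IsStableUnderColimitsOfShape
    (Finset (Discrete α))).condition _ _ _ _
    (isColimitFiniteSubproductsCocone f)
    (isColimitConstCocone (Finset (Discrete α)) (∏ᶜ f))
    { app := fun S => (finiteSubcoproductsCocone f).ι.app S ≫ Pi.lift (Limits.Sigma.π f)
      naturality := fun S S' φ => by
        rw [← Category.assoc, (finiteSubcoproductsCocone f).w φ]
        exact (Category.comp_id _).symm } ?_ _ (fun S => (Category.comp_id _).symm)
  intro S
  refine Preadditive.mono_of_cancel_zero _ (fun {Z} g hg => eq_zero_of_comp_sigmaπ (fun b => ?_))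
  replace hg : g ≫ Limits.Sigma.desc (fun s : S => Sigma.ι f s.1.as) ≫
    Pi.lift (Limits.Sigma.π f) = 0 := hg
  have h : Limits.Sigma.π (fun s : S => f s.1.as) b =
      Limits.Sigma.desc (fun s : S => Sigma.ι f s.1.as) ≫ Limits.Sigma.π f b.1.as := by
    apply Sigma.hom_ext
    intro s
    by_cases h : s = b
    · subst h
      simp
    · have : s.1.as ≠ b.1.as := fun h' => h (Subtype.ext (Discrete.ext h'))
      simp [Limits.Sigma.ι_π_of_ne _ this, Limits.Sigma.ι_π_of_ne _ h]
  have h' := hg =≫ Pi.π (fun i => f i) b.1.as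
  rw [zero_comp] at h'
  refine Eq.trans ?_ h'
  refine (g ≫= h).trans ?_
  refine Eq.trans ?_ (Category.assoc g _ _).symm
  refine g ≫= ((_ ≫= ?_).trans (Category.assoc _ _ _).symm)
  exact (Pi.lift_π (Limits.Sigma.π f) b.1.as).symm

variable (F : ℕ ⥤ B)

/-- The terms of a sequence, indexed by a type in the universe `t`. -/
abbrev terms (k : ULift.{w} ℕ) : B := F.obj k.down

/-- The difference of the identity and of the transition maps, on the coproduct of a sequence. -/
def telescopeMap : ∐ (terms.{w} F) ⟶
    ∐ (terms.{w} F) :=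
  𝟙 _ - Limits.Sigma.desc (fun k : ULift.{w} ℕ => F.map (homOfLE (Nat.le_succ k.down)) ≫
    Sigma.ι (terms.{w} F) ⟨k.down + 1⟩)

lemma ι_telescopeMap (k : ℕ) : Sigma.ι (terms.{w} F) ⟨k⟩ ≫
    telescopeMap.{w} F = Sigma.ι (terms.{w} F) ⟨k⟩ -
      F.map (homOfLE (Nat.le_succ k)) ≫
        Sigma.ι (terms.{w} F) ⟨k + 1⟩ := by
  simp [telescopeMap, Preadditive.comp_sub]

lemma telescopeMap_π_zero : telescopeMap.{w} F ≫
    Limits.Sigma.π (terms.{w} F) ⟨0⟩ = Limits.Sigma.π (terms.{w} F) ⟨0⟩ := by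
  apply Sigma.hom_ext
  rintro ⟨k⟩
  have := Limits.Sigma.ι_π_of_ne (terms.{w} F) (b := ⟨k + 1⟩) (c := ⟨0⟩) (by simp)
  rw [← Category.assoc, ι_telescopeMap, Preadditive.sub_comp, Category.assoc, this, comp_zero,
    sub_zero]

lemma telescopeMap_π_succ (n : ℕ) : telescopeMap.{w} F ≫
    Limits.Sigma.π (terms.{w} F) ⟨n + 1⟩ = Limits.Sigma.π (terms.{w} F) ⟨n + 1⟩ -
      Limits.Sigma.π (terms.{w} F) ⟨n⟩ ≫
        F.map (homOfLE (Nat.le_succ n)) := by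
  apply Sigma.hom_ext
  rintro ⟨k⟩
  rw [← Category.assoc, ι_telescopeMap, Preadditive.sub_comp, Category.assoc,
    Preadditive.comp_sub]
  congr 1
  by_cases h : k = n
  · subst h
    simp
  · rw [Limits.Sigma.ι_π_of_ne _ (by simpa using h), comp_zero, ← Category.assoc,
      Limits.Sigma.ι_π_of_ne _ (by simpa using h), zero_comp]

/-- The coordinates of a map killed by the telescope map vanish one after the other, by the formulas
for `Limits.Sigma.π`, and the coordinates are jointly monic. -/
instance mono_telescopeMap : Mono (telescopeMap.{w} F) := by
  refine Preadditive.mono_of_cancel_zero _ (fun {Z} g hg => ?_)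
  have h (n : ℕ) : g ≫ Limits.Sigma.π (terms.{w} F) ⟨n⟩ = 0 := by
    induction n with
    | zero => rw [← telescopeMap_π_zero, ← Category.assoc, hg, zero_comp]
    | succ n hn =>
      have := telescopeMap_π_succ.{w} F n
      rw [eq_sub_iff_add_eq] at this
      rw [← this, Preadditive.comp_add, ← Category.assoc, hg, zero_comp, ← Category.assoc, hn,
        zero_comp, add_zero]
  have := mono_piLift_sigmaπ (terms.{w} F)
  rw [← cancel_mono (Pi.lift (Limits.Sigma.π (terms.{w} F)))]
  apply Pi.hom_ext
  rintro ⟨n⟩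
  simp [h]

variable {F}

lemma telescope_zero (c : Cocone F) :
    telescopeMap.{w} F ≫ Limits.Sigma.desc (fun k : ULift.{w} ℕ => c.ι.app k.down) = 0 := by
  apply Sigma.hom_ext
  rintro ⟨k⟩
  rw [← Category.assoc, ι_telescopeMap, Preadditive.sub_comp]
  simp

/-- This makes a sequential colimit of complexes the cone of a map between coproducts, so suspended
classes closed under coproducts contain it. -/
lemma telescope_shortExact {c : Cocone F} (hc : IsColimit c) :
    (ShortComplex.mk _ _ (telescope_zero.{w} c)).ShortExact := by
  have hS : IsColimit (CokernelCofork.ofπ _ (telescope_zero.{w} c)) :=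
    CokernelCofork.IsColimit.ofπ _ _
      (fun {Z} g hg => hc.desc ⟨Z,
        NatTrans.ofSequence (fun k => Sigma.ι (terms.{w} F) ⟨k⟩ ≫ g) (fun k => by
          have := Sigma.ι (terms.{w} F) ⟨k⟩ ≫= hg
          rw [← Category.assoc, ι_telescopeMap, Preadditive.sub_comp, comp_zero, sub_eq_zero] at this
          simpa using this.symm)⟩)
      (fun {Z} g hg => by
        apply Sigma.hom_ext
        rintro ⟨k⟩
        simp)
      (fun {Z} g hg m hm => hc.hom_ext (fun k => by
        simp [← hm]))
  exact { exact := ShortComplex.exact_of_g_is_cokernel _ hS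
          mono_f := by dsimp; infer_instance
          epi_g := epi_of_isColimit_cofork hS }

end Telescope

/-! ### Brutal truncations -/

section BrutalTruncation

variable {A : Type u} [Category.{v} A] [Abelian A] (K : CochainComplex A ℤ)

/-- The projection of the term of degree `i` of a complex to the degrees `< p`. -/
def lowerProjection (p i : ℤ) : K.X i ⟶ K.X i := if i < p then 𝟙 _ else 0

/-- The term of degree `i` of the brutal truncation of a complex to the degrees `≥ p`. -/
abbrev brutalTruncX (p i : ℤ) : A := kernel (lowerProjection K p i)

/-- The inclusion of the term of degree `i` of the brutal truncation. -/
abbrev brutalTruncXι (p i : ℤ) : brutalTruncX K p i ⟶ K.X i := kernel.ι _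

lemma isIso_brutalTruncXι {p i : ℤ} (h : p ≤ i) : IsIso (brutalTruncXι K p i) := by
  have : lowerProjection K p i = 0 := if_neg (by lia)
  exact ⟨kernel.lift _ (𝟙 _) (by rw [this, comp_zero]),
    by rw [← cancel_mono (brutalTruncXι K p i)]; simp, by simp⟩

lemma isZero_brutalTruncX {p i : ℤ} (h : i < p) : IsZero (brutalTruncX K p i) := by
  have : IsIso (lowerProjection K p i) := by rw [lowerProjection, if_pos h]; infer_instance
  exact isZero_kernel_of_mono _

/-- Morphisms to the terms of a brutal truncation. -/
def brutalTruncXLift {p i : ℤ} {Z : A} (f : Z ⟶ K.X i) (hf : i < p → f = 0) :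
    Z ⟶ brutalTruncX K p i :=
  kernel.lift _ f (by
    by_cases hi : i < p
    · rw [hf hi, zero_comp]
    · exact (congr_arg (f ≫ ·) (if_neg hi)).trans comp_zero)

lemma brutalTruncXLift_ι {p i : ℤ} {Z : A} (f : Z ⟶ K.X i) (hf : i < p → f = 0) :
    brutalTruncXLift K f hf ≫ brutalTruncXι K p i = f :=
  kernel.lift_ι _ _ _

/-- The differential of the brutal truncation. -/
def brutalTruncD (p i j : ℤ) : brutalTruncX K p i ⟶ brutalTruncX K p j :=
  brutalTruncXLift K (brutalTruncXι K p i ≫ K.d i j) (fun hj => by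
    by_cases hij : (ComplexShape.up ℤ).Rel i j
    · have : i + 1 = j := hij
      exact (isZero_brutalTruncX K (by lia)).eq_of_src _ _
    · rw [K.shape i j hij, comp_zero])

lemma brutalTruncD_ι (p i j : ℤ) :
    brutalTruncD K p i j ≫ brutalTruncXι K p j = brutalTruncXι K p i ≫ K.d i j :=
  brutalTruncXLift_ι K _ _

/-- The brutal truncation of a complex `K`: the subcomplex of `K` which coincides with `K`
in degrees `≥ p` and vanishes in degrees `< p`. -/
abbrev brutalTrunc (p : ℤ) : CochainComplex A ℤ where
  X i := brutalTruncX K p i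
  d i j := brutalTruncD K p i j
  shape i j h := by
    rw [← cancel_mono (brutalTruncXι K p j), brutalTruncD_ι, K.shape i j h, comp_zero, zero_comp]
  d_comp_d' i j k _ _ := by
    rw [← cancel_mono (brutalTruncXι K p k), Category.assoc, brutalTruncD_ι, ← Category.assoc,
      brutalTruncD_ι, Category.assoc, K.d_comp_d, comp_zero, zero_comp]

/-- The inclusion of a brutal truncation. -/
def brutalTruncι (p : ℤ) : brutalTrunc K p ⟶ K where
  f i := brutalTruncXι K p i
  comm' i j _ := (brutalTruncD_ι K p i j).symm

instance (p : ℤ) : Mono (brutalTruncι K p) :=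
  have (i : ℤ) : Mono ((brutalTruncι K p).f i) := inferInstanceAs (Mono (brutalTruncXι K p i))
  HomologicalComplex.mono_of_mono_f _ this

lemma isIso_brutalTruncι_f {p i : ℤ} (h : p ≤ i) : IsIso ((brutalTruncι K p).f i) :=
  isIso_brutalTruncXι K h

lemma isZero_brutalTrunc_X {p i : ℤ} (h : i < p) : IsZero ((brutalTrunc K p).X i) :=
  isZero_brutalTruncX K h

/-- The inclusions between brutal truncations. -/
def brutalTruncMap {p q : ℤ} (h : q ≤ p) : brutalTrunc K p ⟶ brutalTrunc K q where
  f i := brutalTruncXLift K (brutalTruncXι K p i) (fun hi =>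
      (isZero_brutalTruncX K (by lia)).eq_of_src _ _)
  comm' i j hij := by
    dsimp
    rw [← cancel_mono (brutalTruncXι K q j), Category.assoc, Category.assoc, brutalTruncD_ι,
      brutalTruncXLift_ι, brutalTruncD_ι, ← Category.assoc, brutalTruncXLift_ι]

lemma brutalTruncMap_ι {p q : ℤ} (h : q ≤ p) :
    brutalTruncMap K h ≫ brutalTruncι K q = brutalTruncι K p := by
  ext i
  exact brutalTruncXLift_ι K (brutalTruncXι K p i) (fun hi =>
      (isZero_brutalTruncX K (by lia)).eq_of_src _ _)

/-- A complex is the union of its brutal truncations. -/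
def brutalTruncFunctor : ℕ ⥤ CochainComplex A ℤ where
  -- The sequence starts with the degrees ≥ 1, so its first term is zero when K lives in degrees ≤
  -- 0.
  obj n := brutalTrunc K (1 - n)
  map {m n} φ := brutalTruncMap K (by have := leOfHom φ; lia)
  map_id n := by rw [← cancel_mono (brutalTruncι K _), brutalTruncMap_ι, Category.id_comp]
  map_comp φ ψ := by
    rw [← cancel_mono (brutalTruncι K _), brutalTruncMap_ι, Category.assoc, brutalTruncMap_ι,
      brutalTruncMap_ι]

/-- The cocone of the brutal truncations of a complex. -/
def brutalTruncCocone : Cocone (brutalTruncFunctor K) where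
  pt := K
  ι := { app n := brutalTruncι K _
         naturality m n φ := (brutalTruncMap_ι K (by have := leOfHom φ; lia)).trans
           (Category.comp_id _).symm }

/-- A cocone of a sequence is a colimit if its components are eventually isomorphisms. -/
def isColimitOfIsIso {B : Type*} [Category* B] {F : ℕ ⥤ B} (c : Cocone F) (N : ℕ)
    (h : ∀ n, N ≤ n → IsIso (c.ι.app n)) : IsColimit c :=
  have := h N le_rfl
  { desc s := inv (c.ι.app N) ≫ s.ι.app N
    fac s n := by
      obtain hn | hn := le_total n N
      · rw [← c.w (homOfLE hn), Category.assoc, IsIso.hom_inv_id_assoc, s.w]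
      · have := h n hn
        have : IsIso (F.map (homOfLE hn)) := IsIso.of_isIso_fac_right (c.w (homOfLE hn))
        rw [← cancel_epi (F.map (homOfLE hn)), ← Category.assoc, c.w, IsIso.hom_inv_id_assoc, s.w]
    uniq s m hm := by
      rw [IsIso.eq_inv_comp]
      exact hm _ }

/-- A complex is the colimit of its brutal truncations. -/
def isColimitBrutalTruncCocone : IsColimit (brutalTruncCocone K) :=
  HomologicalComplex.isColimitOfEval _ _ (fun i => isColimitOfIsIso _ (1 - i).toNat
    (fun n hn => isIso_brutalTruncι_f K (p := 1 - n) (by lia)))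

instance (p q : ℤ) (h : q ≤ p) : Mono (brutalTruncMap K h) :=
  mono_of_mono_fac (brutalTruncMap_ι K h)

lemma isIso_brutalTruncMap_f {p q i : ℤ} (h : q ≤ p) (hi : p ≤ i) :
    IsIso ((brutalTruncMap K h).f i) := by
  have := isIso_brutalTruncι_f K hi
  have := isIso_brutalTruncι_f K (h.trans hi)
  have fac : (brutalTruncMap K h).f i ≫ (brutalTruncι K q).f i = (brutalTruncι K p).f i := by
    rw [← HomologicalComplex.comp_f, brutalTruncMap_ι]
  exact IsIso.of_isIso_fac_right fac

/-- Evaluation of the cokernel of a morphism of complexes. -/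
def cokernelXIso {K L : CochainComplex A ℤ} (f : K ⟶ L) (i : ℤ) :
    (cokernel f).X i ≅ cokernel (f.f i) :=
  PreservesCokernel.iso (HomologicalComplex.eval A _ i) f

lemma exists_iso_single_cokernel_brutalTruncMap (p : ℤ) :
    Nonempty (cokernel (brutalTruncMap K (p := p + 1) (q := p) (by lia)) ≅
      (HomologicalComplex.single A (.up ℤ) p).obj (K.X p)) := by
  set f := brutalTruncMap K (p := p + 1) (q := p) (by lia)
  have h₁ : (cokernel f).IsStrictlyLE p := (CochainComplex.isStrictlyLE_iff _ _).2 (fun i hi => by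
    have := isIso_brutalTruncMap_f K (p := p + 1) (q := p) (by lia) hi
    exact (isZero_cokernel_of_epi (f.f i)).of_iso (cokernelXIso f i))
  have h₂ : (cokernel f).IsStrictlyGE p := (CochainComplex.isStrictlyGE_iff _ _).2 (fun i hi => by
    rw [IsZero.iff_id_eq_zero, ← cancel_epi ((cokernel.π f).f i)]
    exact (isZero_brutalTrunc_X K hi).eq_of_src _ _)
  obtain ⟨M, ⟨e⟩⟩ := (cokernel f).exists_iso_single p
  have := isIso_brutalTruncι_f K (le_refl p)
  let e' : M ≅ K.X p := (HomologicalComplex.singleObjXSelf (.up ℤ) p M).symm ≪≫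
    (HomologicalComplex.eval A _ p).mapIso e.symm ≪≫ cokernelXIso f p ≪≫
    cokernelIsoOfEq ((isZero_brutalTrunc_X K (by lia : p < p + 1)).eq_of_src (f.f p) 0) ≪≫
      cokernelZeroIsoTarget ≪≫ asIso ((brutalTruncι K p).f p)
  exact ⟨e ≪≫ (HomologicalComplex.single A (.up ℤ) p).mapIso e'⟩

end BrutalTruncation

/-! ### Building complexes from their terms -/

section Derived

variable {A : Type u} [Category.{v} A] [Abelian A] [HasDerivedCategory.{t} A]
  {S : ObjectProperty (DerivedCategory A)}

open DerivedCategory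

lemma IsSuspended.Q_of_shortExact (hS : IsSuspended S) {X : ShortComplex (CochainComplex A ℤ)}
    (hX : X.ShortExact) (h₁ : S (Q.obj X.X₁)) (h₃ : S (Q.obj X.X₃)) : S (Q.obj X.X₂) :=
  hS.extension _ (triangleOfSES_distinguished hX) h₁ h₃

lemma IsSuspended.Q_of_shortExact₃ (hS : IsSuspended S) {X : ShortComplex (CochainComplex A ℤ)}
    (hX : X.ShortExact) (h₁ : S (Q.obj X.X₁)) (h₂ : S (Q.obj X.X₂)) : S (Q.obj X.X₃) :=
  hS.cone _ (triangleOfSES_distinguished hX) h₁ h₂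

lemma shortExact_cokernel {B : Type*} [Category* B] [Abelian B] {X Y : B} (f : X ⟶ Y) [Mono f] :
    (ShortComplex.mk f (cokernel.π f) (cokernel.condition f)).ShortExact where
  exact := ShortComplex.exact_cokernel f

lemma IsClosedUnderCoproducts.zero (hS' : IsClosedUnderCoproducts.{w} S)
    {X : DerivedCategory A} (hX : IsZero X) : S X :=
  hS' PEmpty (fun x => x.elim) (Cofan.mk X (fun x => x.elim))
    (Cofan.IsColimit.mk _ (fun _ => hX.to_ _) (fun _ x => x.elim) (fun _ _ _ => hX.eq_of_src _ _))
    (fun x => x.elim)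

lemma IsSuspended.Q_single (hS : IsSuspended S) {M : A} (hM : S ((singleFunctor A 0).obj M))
    {p : ℤ} (hp : p ≤ 0) : S (Q.obj ((HomologicalComplex.single A (.up ℤ) p).obj M)) := by
  have e : ((singleFunctor A 0).obj M)⟦-p⟧ ≅ (singleFunctor A p).obj M :=
    ((singleFunctors A).shiftIso (-p) p 0 (by lia)).app M
  exact hS.of_iso (e ≪≫ (singleFunctorIsoCompQ A p).app M) (hS.shift _ (-p) (by lia) hM)

variable [IsGrothendieckAbelian.{w} A]

lemma IsClosedUnderCoproducts.Q_sigma (hS' : IsClosedUnderCoproducts.{w} S)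
    {J : Type w} (X : J → CochainComplex A ℤ) (hX : ∀ j, S (Q.obj (X j))) : S (Q.obj (∐ X)) :=
  hS' J _ _ (isColimitCofanMkObjOfIsColimit Q X (fun j => Sigma.ι X j) (coproductIsCoproduct X)) hX

lemma IsSuspended.Q_sequentialColimit (hS : IsSuspended S) (hS' : IsClosedUnderCoproducts.{w} S)
    {F : ℕ ⥤ CochainComplex A ℤ} {c : Cocone F} (hc : IsColimit c)
    (hF : ∀ n, S (Q.obj (F.obj n))) : S (Q.obj c.pt) :=
  hS.Q_of_shortExact₃ (telescope_shortExact.{w} hc) (hS'.Q_sigma _ (fun k => hF k.down))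
    (hS'.Q_sigma _ (fun k => hF k.down))

/-- K is the sequential colimit of its brutal truncations. Each one extends a stalk `(K.X i)[-i]`,
with -i ≥ 0, by the previous one, so only extensions, positive shifts and the telescope are needed.
-/
lemma IsSuspended.Q_of_terms (hS : IsSuspended S) (hS' : IsClosedUnderCoproducts.{w} S)
    (K : CochainComplex A ℤ) [K.IsStrictlyLE 0]
    (hK : ∀ i, S ((singleFunctor A 0).obj (K.X i))) : S (Q.obj K) := by
  refine hS.Q_sequentialColimit hS' (isColimitBrutalTruncCocone K) (fun n => ?_)
  change S (Q.obj (brutalTrunc K (1 - n)))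
  induction n with
  | zero =>
    refine hS'.zero (Functor.map_isZero _ ?_)
    rw [IsZero.iff_id_eq_zero]
    refine HomologicalComplex.hom_ext _ _ (fun i => ?_)
    by_cases hi : i < 1
    · exact (isZero_brutalTrunc_X K (by simpa using hi)).eq_of_src _ _
    · refine (cancel_mono ((brutalTruncι K _).f i)).1 ?_
      exact (K.isZero_of_isStrictlyLE 0 i (by lia)).eq_of_tgt _ _
  | succ n hn =>
    obtain ⟨e⟩ := exists_iso_single_cokernel_brutalTruncMap K (-n)
    have h₁ : 1 - ((n + 1 : ℕ) : ℤ) = -n := by lia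
    have h₂ : 1 - (n : ℤ) = -n + 1 := by lia
    rw [h₁]
    rw [h₂] at hn
    exact hS.Q_of_shortExact (shortExact_cokernel (brutalTruncMap K (p := -n + 1) (q := -n)
      (by lia))) hn (hS.of_iso (Q.mapIso e.symm) (hS.Q_single (hK _) (by lia)))

end Derived

/-! ### Generation of the standard aisle by projectives -/

section StandardAisle

variable {A : Type u} [Category.{v} A] [Abelian A] [HasDerivedCategory.{t} A]
  {S : ObjectProperty (DerivedCategory A)}

open DerivedCategory

/-- The isomorphism in the derived category between an object and one of its resolutions. -/
def singleIsoOfQuasiIso {X : A} {K : CochainComplex A ℤ}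
    (f : K ⟶ (CochainComplex.singleFunctor A 0).obj X) [QuasiIso f] :
    Q.obj K ≅ (singleFunctor A 0).obj X :=
  asIso (Q.map f) ≪≫ ((singleFunctorIsoCompQ A 0).app X).symm

/-- The isomorphism in the derived category between an object and one of its coresolutions. -/
def singleIsoOfQuasiIso' {X : A} {K : CochainComplex A ℤ}
    (f : (CochainComplex.singleFunctor A 0).obj X ⟶ K) [QuasiIso f] :
    Q.obj K ≅ (singleFunctor A 0).obj X :=
  (asIso (Q.map f)).symm ≪≫ ((singleFunctorIsoCompQ A 0).app X).symm

variable [IsGrothendieckAbelian.{w} A]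

lemma IsSuspended.of_isLE (hS : IsSuspended S) (hS' : IsClosedUnderCoproducts.{w} S)
    [EnoughProjectives A] (h : ∀ P : A, Projective P → S ((singleFunctor A 0).obj P))
    {a : ℤ} (ha : a ≤ 0) (X : DerivedCategory A) [X.IsLE a] : S X := by
  have : X.IsLE 0 := TStructure.t.isLE_of_le X a 0 ha
  obtain ⟨K, hK, ⟨e⟩⟩ := X.exists_iso_Q_obj_of_isLE 0
  -- `IsSuspended.Q_of_terms` is used twice: it reduces K to its terms, and then the projective
  -- resolution of each term to projective objects.
  refine hS.of_iso e.symm (hS.Q_of_terms hS' K (fun i => ?_))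
  let P := ProjectiveResolution.of (K.X i)
  exact hS.of_iso (singleIsoOfQuasiIso P.π') (hS.Q_of_terms hS' P.cochainComplex
    (fun j => h _ inferInstance))

lemma IsSuspended.single_of_isColimit (hS : IsSuspended S) (hS' : IsClosedUnderCoproducts.{w} S)
    {J : Type w} {X : J → A} {c : Cofan X} (hc : IsColimit c)
    (hX : ∀ j, S ((singleFunctor A 0).obj (X j))) : S ((singleFunctor A 0).obj c.pt) := by
  let e := singleFunctorIsoCompQ A 0
  have : PreservesColimitsOfShape (Discrete J) (CochainComplex.singleFunctor A 0) :=
    inferInstanceAs (PreservesColimitsOfShape (Discrete J) (HomologicalComplex.single A (.up ℤ) 0))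
  refine hS.of_iso (e.symm.app c.pt) ?_
  exact hS' J _ _ (isColimitCofanMkObjOfIsColimit (CochainComplex.singleFunctor A 0 ⋙ Q) X
    (fun j => c.inj j) (IsColimit.ofIsoColimit hc (Cofan.ext (Iso.refl c.pt) (fun j => by simp))))
    (fun j => hS.of_iso (e.app (X j)) (hX j))

end StandardAisle

/-! ### Module-theoretic input: free modules and the tilting coresolution -/

section Modules

variable {R : Type u} [Ring R]

/-- The injections of a copower of a module. -/
def copowerι (T : RMod R) (α : Type u) (a : α) : T ⟶ copower T α :=
  ModuleCat.ofHom (Finsupp.lsingle a)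

/-- A copower of a module is a coproduct. -/
def isColimitCopower (T : RMod R) (α : Type u) :
    IsColimit (Cofan.mk (copower T α) (copowerι T α)) :=
  Cofan.IsColimit.mk _
    (fun s => ModuleCat.ofHom (Finsupp.lsum ℕ (fun a => (s.inj a).hom)))
    (fun s a => by
      ext x
      exact Finsupp.lsum_single ℕ (fun a => (s.inj a).hom) a x)
    (fun s m hm => by
      refine ModuleCat.hom_ext (Finsupp.lhom_ext (fun a x => ?_))
      exact (ConcreteCategory.congr_hom (hm a) x).trans
        (Finsupp.lsum_single ℕ (fun a => (s.inj a).hom) a x).symm)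

/-- The map from the regular module which is attached to an element of a module. -/
def ofElement {M : RMod R} (m : M) : regular R ⟶ M :=
  ModuleCat.ofHom
    { toFun r := MulOpposite.op (r : R) • m
      map_add' r s := by
        rw [← add_smul]
        rfl
      map_smul' r s := by
        rw [RingHom.id_apply, smul_smul]
        rfl }

lemma exists_retract_copower_regular (P : RMod R) [Projective P] :
    IsSummandOfCopower (regular R) P := by
  let p : copower (regular R) P ⟶ P :=
    Cofan.IsColimit.desc (isColimitCopower (regular R) P) (fun m => ofElement m)
  have hp (m : P) : p (copowerι (regular R) P m (1 : R)) = m := by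
    have := ConcreteCategory.congr_hom
      (Cofan.IsColimit.fac (isColimitCopower (regular R) P) (fun m => ofElement m) m) (1 : R)
    refine Eq.trans this ?_
    exact one_smul Rᵐᵒᵖ m
  have : Epi p := by
    rw [ModuleCat.epi_iff_surjective]
    exact fun m => ⟨_, hp m⟩
  exact ⟨P, ⟨⟨Projective.factorThru (𝟙 P) p, p, Projective.factorThru_comp _ _⟩⟩⟩

variable [HasDerivedCategory.{t} (RMod R)] {S : ObjectProperty (DerivedCategory (RMod R))}

open DerivedCategory

lemma IsSuspended.stalk_of_isSummandOfCopower (hS : IsSuspended S)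
    (hS' : IsClosedUnderCoproducts.{u} S) {T M : RMod R} (h : IsSummandOfCopower T M)
    (hT : S (stalk T)) : S (stalk M) := by
  obtain ⟨α, ⟨r⟩⟩ := h
  have := derivedCategory_hasCoproductsOfShape (RMod R) (ULift.{u} ℕ)
  exact hS.retract hS' (r.map (singleFunctor (RMod R) 0))
    (hS.single_of_isColimit hS' (isColimitCopower T α) (fun _ => hT))

lemma IsSuspended.of_isLE_zero (hS : IsSuspended S) (hS' : IsClosedUnderCoproducts.{u} S)
    (h : S (stalk (regular R))) (X : DerivedCategory (RMod R)) [X.IsLE 0] : S X :=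
  hS.of_isLE hS' (fun P _ =>
    hS.stalk_of_isSummandOfCopower hS' (exists_retract_copower_regular P) h) le_rfl X

/-- In the derived category R is the complex T₀ → ⋯ → Tₙ in degrees 0 to n. The shift by n moves it
to degrees ≤ 0, where `IsSuspended.Q_of_terms` applies. -/
lemma IsSuspended.regular_of_coresolution (hS : IsSuspended S)
    (hS' : IsClosedUnderCoproducts.{u} S) {n : ℕ} {T : RMod R} (hT : IsTilting n T)
    (h : S (stalk T)) : S ((stalk (regular R))⟦(n : ℤ)⟧) := by
  obtain ⟨K, ε, hε, hK, hK'⟩ := hT.coresolution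
  let L : CochainComplex (RMod R) ℤ := K.extend ComplexShape.embeddingUpNat
  have hL : L.IsStrictlyLE n := (CochainComplex.isStrictlyLE_iff _ _).2 (fun i hi => by
    obtain ⟨k, rfl⟩ := Int.eq_ofNat_of_zero_le (by lia : 0 ≤ i)
    exact (hK' k (by lia)).of_iso (K.extendXIso ComplexShape.embeddingUpNat rfl))
  let f : (CochainComplex.singleFunctor (RMod R) 0).obj (regular R) ⟶ L :=
    (HomologicalComplex.extendSingleIso ComplexShape.embeddingUpNat (regular R) 0 0 (by simp)).inv ≫
      HomologicalComplex.extendMap ε ComplexShape.embeddingUpNat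
  have : QuasiIso (HomologicalComplex.extendMap ε ComplexShape.embeddingUpNat) := inferInstance
  have hf : QuasiIso f := quasiIso_comp (HomologicalComplex.extendSingleIso
    ComplexShape.embeddingUpNat (regular R) 0 0 (by simp)).inv
      (HomologicalComplex.extendMap ε ComplexShape.embeddingUpNat)
  have : (L⟦(n : ℤ)⟧).IsStrictlyLE 0 := L.isStrictlyLE_shift n n 0 (by lia)
  have key : S (Q.obj (L⟦(n : ℤ)⟧)) := hS.Q_of_terms hS' _ (fun i => by
    change S (stalk (L.X (i + n)))
    generalize i + (n : ℤ) = j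
    by_cases hj : 0 ≤ j
    · obtain ⟨k, rfl⟩ := Int.eq_ofNat_of_zero_le hj
      refine hS.of_iso ((singleFunctor _ 0).mapIso
        (K.extendXIso ComplexShape.embeddingUpNat (i := k) rfl).symm) ?_
      by_cases hk : k ≤ n
      · exact hS.stalk_of_isSummandOfCopower hS' (hK k hk) h
      · exact hS'.zero (Functor.map_isZero _ (hK' k (by lia)))
    · exact hS'.zero (Functor.map_isZero _ (K.isZero_extend_X ComplexShape.embeddingUpNat j
        (fun k hk => hj (by simp at hk; lia)))))
  exact hS.of_iso ((Q.commShiftIso (n : ℤ)).app L ≪≫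
    (shiftFunctor _ (n : ℤ)).mapIso (singleIsoOfQuasiIso' f)) key

end Modules

/-! ### Free diagrams: left Kan extension from the underlying discrete diagram -/

section FreeDiagram

variable {B : Type u} [Category.{v} B] {J : Type w} [SmallCategory J] (F : J ⥤ B)

/-- The family of the sources of the morphisms to a given index. -/
abbrev overFamily (γ : J) (p : Σ β : J, β ⟶ γ) : B := F.obj p.1

variable [HasCoproducts.{w} B]

/-- The injections of the free diagram. -/
def freeι {β γ : J} (f : β ⟶ γ) : F.obj β ⟶ ∐ (overFamily F γ) :=
  Sigma.ι (overFamily F γ) ⟨β, f⟩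

/-- Morphisms from the terms of the free diagram. -/
def freeDesc {γ : J} {Z : B} (φ : ∀ (β : J) (_ : β ⟶ γ), F.obj β ⟶ Z) :
    ∐ (overFamily F γ) ⟶ Z :=
  Limits.Sigma.desc (fun p => φ p.1 p.2)

lemma freeι_desc {β γ : J} {Z : B} (φ : ∀ (β : J) (_ : β ⟶ γ), F.obj β ⟶ Z) (f : β ⟶ γ) :
    freeι F f ≫ freeDesc F φ = φ β f :=
  Sigma.ι_desc (f := overFamily F γ) _ _

lemma freeι_desc_assoc {β γ : J} {Z : B} (φ : ∀ (β : J) (_ : β ⟶ γ), F.obj β ⟶ Z) (f : β ⟶ γ)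
    {Z' : B} (h : Z ⟶ Z') : freeι F f ≫ freeDesc F φ ≫ h = φ β f ≫ h := by
  rw [← Category.assoc, freeι_desc]

lemma free_hom_ext {γ : J} {Z : B} {g h : ∐ (overFamily F γ) ⟶ Z}
    (H : ∀ (β : J) (f : β ⟶ γ), freeι F f ≫ g = freeι F f ≫ h) : g = h :=
  Sigma.hom_ext _ _ (fun p => H p.1 p.2)

/-- The free diagram on the objects of a diagram. -/
@[simps]
def freeDiagram : J ⥤ B where
  obj γ := ∐ (overFamily F γ)
  map g := freeDesc F (fun _ f => freeι F (f ≫ g))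
  map_id γ := free_hom_ext F (fun β f => by rw [freeι_desc, Category.comp_id, Category.comp_id])
  map_comp g h := free_hom_ext F (fun β f => by
    rw [freeι_desc, freeι_desc_assoc, freeι_desc, Category.assoc])

/-- The counit from the free diagram on the objects of a diagram. -/
@[simps]
def freeDiagramCounit : freeDiagram F ⟶ F where
  app γ := freeDesc F (fun _ f => F.map f)
  naturality γ δ g := free_hom_ext F (fun β f => by
    change freeι F f ≫ freeDesc F (fun _ f => freeι F (f ≫ g)) ≫ freeDesc F (fun _ f => F.map f) =
      freeι F f ≫ freeDesc F (fun _ f => F.map f) ≫ F.map g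
    rw [freeι_desc_assoc, freeι_desc, freeι_desc_assoc, F.map_comp])

/-- The counit splits at each object, though in general not naturally; this keeps the values of its
kernel in S. -/
lemma freeι_freeDiagramCounit_app (γ : J) :
    freeι F (𝟙 γ) ≫ (freeDiagramCounit F).app γ = 𝟙 _ := by
  rw [freeDiagramCounit_app, freeι_desc, F.map_id]

/-- The coproduct of all objects, as a cocone of the free diagram. -/
@[simps]
def freeDiagramCocone : Cocone (freeDiagram F) where
  pt := ∐ F.obj
  ι :=
    { app γ := freeDesc F (fun β _ => Sigma.ι F.obj β)
      naturality γ δ g := free_hom_ext F (fun β f => by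
        change freeι F f ≫ freeDesc F (fun _ f => freeι F (f ≫ g)) ≫
          freeDesc F (fun β _ => Sigma.ι F.obj β) =
            freeι F f ≫ freeDesc F (fun β _ => Sigma.ι F.obj β) ≫ 𝟙 _
        rw [freeι_desc_assoc, freeι_desc, Category.comp_id, freeι_desc]) }

/-- The colimit of a free diagram is the coproduct of all objects. -/
def isColimitFreeDiagramCocone : IsColimit (freeDiagramCocone F) where
  desc s := Limits.Sigma.desc (fun β => freeι F (𝟙 β) ≫ s.ι.app β)
  fac s γ := free_hom_ext F (fun β f => by
    have h := (freeι_desc_assoc F (fun _ g => freeι F (g ≫ f)) (𝟙 β) (s.ι.app γ)).symm.trans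
      (freeι F (𝟙 β) ≫= s.w f)
    rw [Category.id_comp] at h
    refine (freeι_desc_assoc F (fun β _ => Sigma.ι F.obj β) f _).trans ?_
    rw [Sigma.ι_desc, h])
  uniq s m hm := by
    apply Sigma.hom_ext
    intro β
    rw [Sigma.ι_desc, ← hm]
    exact (freeι_desc_assoc F (fun β _ => Sigma.ι F.obj β) (𝟙 β) m).symm

end FreeDiagram

/-! ### Closure of bounded suspended classes under filtered colimits -/

section FilteredColimits

variable {A : Type u} [Category.{v} A] [Abelian A] [HasDerivedCategory.{t} A]
  {S : ObjectProperty (DerivedCategory A)}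

open DerivedCategory

/-- In a split sequence the kernel is also the cokernel of the section, hence a cone of a map
between objects of S. -/
lemma IsSuspended.Q_of_section (hS : IsSuspended S) {X : ShortComplex (CochainComplex A ℤ)}
    (hX : X.ShortExact) (s : X.X₃ ⟶ X.X₂) (hs : s ≫ X.g = 𝟙 _) (h₂ : S (Q.obj X.X₂))
    (h₃ : S (Q.obj X.X₃)) : S (Q.obj X.X₁) := by
  have := hX.mono_f
  let σ : X.Splitting := ShortComplex.Splitting.ofExactOfSection X hX.exact s hs inferInstance
  let Y : ShortComplex (CochainComplex A ℤ) := ShortComplex.mk σ.s σ.r σ.s_r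
  let τ : Y.Splitting :=
    { r := X.g
      s := X.f
      f_r := σ.s_g
      s_g := σ.f_r
      id := (add_comm _ _).trans σ.id }
  exact hS.Q_of_shortExact₃ τ.shortExact h₃ h₂

variable [IsGrothendieckAbelian.{w} A] {J : Type w} [SmallCategory J]

/-- The short exact sequence of diagrams which is given by the free diagram. -/
abbrev freeDiagramShortComplex (F : J ⥤ CochainComplex A ℤ) :
    ShortComplex (J ⥤ CochainComplex A ℤ) :=
  ShortComplex.mk (kernel.ι (freeDiagramCounit F)) (freeDiagramCounit F) (kernel.condition _)

lemma freeDiagramShortComplex_shortExact (F : J ⥤ CochainComplex A ℤ) :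
    (freeDiagramShortComplex F).ShortExact where
  exact := ShortComplex.exact_kernel _
  epi_g := by
    have (γ : J) : Epi ((freeDiagramCounit F).app γ) :=
      (SplitEpi.mk _ (freeι_freeDiagramCounit_app F γ)).epi
    exact NatTrans.epi_of_epi_app _

lemma isLE_of_isColimit [HasExactColimitsOfShape J A] {F : J ⥤ CochainComplex A ℤ} {c : Cocone F}
    (hc : IsColimit c) {b : ℤ} (hF : ∀ j, (Q.obj (F.obj j)).IsLE b) : (Q.obj c.pt).IsLE b := by
  rw [isLE_Q_obj_iff, CochainComplex.isLE_iff]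
  intro i hi
  refine exactAt_of_isColimit hc i (fun j => ?_)
  have := hF j
  rw [isLE_Q_obj_iff, CochainComplex.isLE_iff] at this
  exact this i hi

/-- Dimension shifting along 0 → N → L → F → 0 with L free: colim L is a coproduct of objects of S,
N again has values in S, and exactness of `colim` makes colim F an extension of (colim N)[1] by
colim L. -/
lemma IsSuspended.Q_filteredColimit [IsFiltered J] (hS : IsSuspended S)
    (hS' : IsClosedUnderCoproducts.{w} S) {a b : ℤ} (ha : TStructure.t.le a ≤ S)
    (hb : S ≤ TStructure.t.le b)
    {F : J ⥤ CochainComplex A ℤ} {c : Cocone F} (hc : IsColimit c)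
    (hF : ∀ j, S (Q.obj (F.obj j))) : S (Q.obj c.pt) := by
  -- Here k counts the dimension shifts already made and m bounds those still needed. At m = 0 the
  -- colimit lies in degrees ≤ b, and its shift by k ≥ b - a lies in degrees ≤ a, hence in S.
  have key (m : ℕ) : ∀ (k : ℕ) (_ : b ≤ a + k + m) (F : J ⥤ CochainComplex A ℤ)
      (_ : ∀ j, S (Q.obj (F.obj j))), S ((Q.obj (colimit F))⟦(k : ℤ)⟧) := by
    induction m with
    | zero =>
      intro k hk F hF
      have : (Q.obj (colimit F)).IsLE b :=
        isLE_of_isColimit (colimit.isColimit F) (fun j => ⟨hb _ (hF j)⟩)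
      have := TStructure.t.isLE_of_le (Q.obj (colimit F)) b (a + k) (by simpa using hk)
      exact ha _ (TStructure.t.isLE_shift (Q.obj (colimit F)) (a + k) k a (by lia)).le
    | succ m hm =>
      intro k hk F hF
      have hX := freeDiagramShortComplex_shortExact F
      have hL (j : J) : S (Q.obj ((freeDiagram F).obj j)) := hS'.Q_sigma _ (fun p => hF p.1)
      have hK := hm (k + 1) (by push_cast at hk ⊢; lia) (freeDiagramShortComplex F).X₁ (fun j =>
        hS.Q_of_section (hX.map_of_exact ((evaluation J _).obj j)) _
          (freeι_freeDiagramCounit_app F j) (hL j) (hF j))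
      have hX' := hX.map_of_exact (colim (J := J) (C := CochainComplex A ℤ))
      have hΔ := Triangle.shift_distinguished _
        (rot_of_distTriang _ (triangleOfSES_distinguished hX')) (k : ℤ)
      refine hS.extension _ hΔ ?_ ?_
      · refine hS.shift _ k (by lia) ?_
        exact hS.of_iso (Q.mapIso ((isColimitFreeDiagramCocone F).coconePointUniqueUpToIso
          (colimit.isColimit _))) (hS'.Q_sigma _ hF)
      · exact hS.of_iso ((shiftFunctorAdd' (DerivedCategory A) (1 : ℤ) (k : ℤ) ((k + 1 : ℕ) : ℤ)
          (by push_cast; lia)).app _) hK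
  have h₀ := key (b - a).toNat 0 (by simp only [Nat.cast_zero]; lia) F hF
  exact hS.of_iso ((shiftFunctorZero _ ℤ).app _ ≪≫
    Q.mapIso ((colimit.isColimit F).coconePointUniqueUpToIso hc)) h₀

end FilteredColimits

/-! ### The small object argument for complexes -/

section Cellular

lemma shortExact_triangleRotateShortComplex {A : Type*} [Category* A] [Abelian A]
    {K L : CochainComplex A ℤ} (φ : K ⟶ L) :
    (CochainComplex.mappingCone.triangleRotateShortComplex φ).ShortExact :=
  HomologicalComplex.shortExact_of_degreewise_shortExact _ (fun i =>
    (CochainComplex.mappingCone.triangleRotateShortComplexSplitting φ i).shortExact)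

variable {A : Type u} [Category.{v} A] [Abelian A] [HasDerivedCategory.{t} A]
  (S : ObjectProperty (DerivedCategory A))

open DerivedCategory

/-- The monomorphisms of complexes the cokernel of which belongs to `S`. -/
def monoWithCokernelIn : MorphismProperty (CochainComplex A ℤ) :=
  fun _ _ f => Mono f ∧ S (Q.obj (cokernel f))

variable {S}

/-- The third term of a short exact sequence is a cokernel. -/
def cokernelIsoOfShortExact {B : Type*} [Category* B] [Abelian B] {X : ShortComplex B}
    (hX : X.ShortExact) : cokernel X.f ≅ X.X₃ :=
  (cokernelIsCokernel X.f).coconePointUniqueUpToIso hX.gIsCokernel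

lemma monoWithCokernelIn_iff_of_shortExact (hS : IsSuspended S)
    {X : ShortComplex (CochainComplex A ℤ)} (hX : X.ShortExact) :
    monoWithCokernelIn S X.f ↔ S (Q.obj X.X₃) :=
  ⟨fun h => hS.of_iso (Q.mapIso (cokernelIsoOfShortExact hX)) h.2,
    fun h => ⟨hX.mono_f, hS.of_iso (Q.mapIso (cokernelIsoOfShortExact hX).symm) h⟩⟩

lemma monoWithCokernelIn_respectsIso (hS : IsSuspended S) : (monoWithCokernelIn S).RespectsIso :=
  MorphismProperty.RespectsIso.of_respects_arrow_iso _ (fun f g e hf => by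
    refine ⟨((MorphismProperty.monomorphisms _).arrow_mk_iso_iff e).1 hf.1, ?_⟩
    exact hS.of_iso (Q.mapIso (cokernel.mapIso f.hom g.hom (Arrow.leftFunc.mapIso e)
      (Arrow.rightFunc.mapIso e) e.hom.w.symm)) hf.2)

lemma shortExact_cokernel_comp {B : Type*} [Category* B] [Abelian B] {X Y Z : B} (f : X ⟶ Y)
    (g : Y ⟶ Z) [Mono g] :
    (ShortComplex.mk (cokernel.map f (f ≫ g) (𝟙 _) g (by simp))
      (cokernel.map (f ≫ g) g f (𝟙 _) (by simp)) (by ext; simp)).ShortExact where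
  exact := (kernelCokernelCompSequence_exact f g).exact 3
  mono_f := ((kernelCokernelCompSequence_exact f g).exact 2).mono_g
    ((isZero_kernel_of_mono g).eq_of_src _ _)
  epi_g := by
    have : Epi (cokernel.π (f ≫ g) ≫ cokernel.map (f ≫ g) g f (𝟙 _) (by simp)) := by
      rw [cokernel.π_desc, Category.id_comp]
      infer_instance
    exact epi_of_epi (cokernel.π (f ≫ g)) _

lemma monoWithCokernelIn_isMultiplicative (hS : IsSuspended S)
    (hS' : IsClosedUnderCoproducts.{w} S) : (monoWithCokernelIn S).IsMultiplicative where
  id_mem X := ⟨inferInstance, hS'.zero (Functor.map_isZero _ (isZero_cokernel_of_epi _))⟩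
  comp_mem f g hf hg := by
    have := hf.1
    have := hg.1
    exact ⟨mono_comp _ _, hS.Q_of_shortExact (shortExact_cokernel_comp f g) hf.2 hg.2⟩

lemma monoWithCokernelIn_isStableUnderCobaseChange (hS : IsSuspended S) :
    (monoWithCokernelIn S).IsStableUnderCobaseChange where
  of_isPushout sq h := by
    have := isIso_cokernel_map_of_isPushout sq.flip
    exact ⟨(MorphismProperty.monomorphisms _).of_isPushout sq h.1,
      hS.of_iso (Q.mapIso (asIso (cokernel.map _ _ _ _ sq.w.symm))) h.2⟩

/-- Exact colimits preserve monomorphisms, and the cokernel of the colimit map is the colimit of the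
cokernels. -/
lemma monoWithCokernelIn_isStableUnderColimitsOfShape (hS : IsSuspended S)
    {J : Type*} [Category* J] [HasColimitsOfShape J (CochainComplex A ℤ)]
    [HasExactColimitsOfShape J (CochainComplex A ℤ)]
    (hJ : ∀ F : J ⥤ CochainComplex A ℤ, (∀ j, S (Q.obj (F.obj j))) → S (Q.obj (colimit F))) :
    (monoWithCokernelIn S).IsStableUnderColimitsOfShape J where
  condition X₁ X₂ c₁ c₂ h₁ h₂ f hf φ hφ := by
    have := monoWithCokernelIn_respectsIso hS
    have (j : J) : Mono (f.app j) := (hf j).1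
    have : Mono f := NatTrans.mono_of_mono_app f
    have hX := shortExact_cokernel f
    have hX' := hX.map_of_exact (colim (J := J) (C := CochainComplex A ℤ))
    have h := (monoWithCokernelIn_iff_of_shortExact hS hX').2 (hJ _ (fun j =>
      (monoWithCokernelIn_iff_of_shortExact hS
        (hX.map_of_exact ((evaluation J _).obj j))).1 (hf j)))
    refine ((monoWithCokernelIn S).arrow_mk_iso_iff (Arrow.isoMk
      ((colimit.isColimit X₁).coconePointUniqueUpToIso h₁)
      ((colimit.isColimit X₂).coconePointUniqueUpToIso h₂) ?_)).1 h
    refine (colimit.isColimit X₁).hom_ext (fun j => ?_)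
    have h₃ := IsColimit.comp_coconePointUniqueUpToIso_hom (colimit.isColimit X₁) h₁ j
    have h₄ := IsColimit.comp_coconePointUniqueUpToIso_hom (colimit.isColimit X₂) h₂ j
    have h₅ := ι_colimMap f j
    refine (Category.assoc _ _ _).symm.trans (((h₃ =≫ φ).trans (hφ j)).trans ?_)
    exact ((f.app j ≫= h₄).symm.trans (Category.assoc _ _ _).symm).trans
      ((h₅.symm =≫ _).trans (Category.assoc _ _ _))

lemma Q_map_surjective_of_isKProjective (K L : CochainComplex A ℤ) [K.IsKProjective] :
    Function.Surjective (fun f : K ⟶ L => Q.map f) := fun φ => by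
  let e := quotientCompQhIso A
  obtain ⟨g, hg⟩ := (CochainComplex.IsKProjective.Qh_map_bijective K
    ((HomotopyCategory.quotient A (.up ℤ)).obj L)).2 ((e.app K).hom ≫ φ ≫ (e.app L).inv)
  obtain ⟨f, rfl⟩ := (HomotopyCategory.quotient _ _).map_surjective g
  refine ⟨f, ?_⟩
  have h : Qh.map ((HomotopyCategory.quotient A (.up ℤ)).map f) ≫ (e.app L).hom =
    (e.app K).hom ≫ Q.map f := e.hom.naturality f
  rw [hg] at h
  rw [← cancel_epi (e.app K).hom]
  simpa using h.symm

variable [IsGrothendieckAbelian.{w} A]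

lemma monoWithCokernelIn_isStableUnderCoproducts (hS : IsSuspended S)
    (hS' : IsClosedUnderCoproducts.{w} S) :
    MorphismProperty.IsStableUnderCoproducts.{w} (monoWithCokernelIn S) where
  isStableUnderCoproductsOfShape _ :=
    monoWithCokernelIn_isStableUnderColimitsOfShape hS (fun F hF =>
      hS.of_iso (Q.mapIso (HasColimit.isoOfNatIso Discrete.natIsoFunctor.symm))
        (hS'.Q_sigma (fun j => F.obj ⟨j⟩) (fun j => hF ⟨j⟩)))

lemma monoWithCokernelIn_isStableUnderFilteredColimits (hS : IsSuspended S)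
    (hS' : IsClosedUnderCoproducts.{w} S) {a b : ℤ} (ha : TStructure.t.le a ≤ S)
    (hb : S ≤ TStructure.t.le b) :
    MorphismProperty.IsStableUnderFilteredColimits.{w, w} (monoWithCokernelIn S) where
  isStableUnderColimitsOfShape _ _ _ :=
    monoWithCokernelIn_isStableUnderColimitsOfShape hS (fun F hF =>
      hS.Q_filteredColimit hS' ha hb (colimit.isColimit F) hF)

/-- The relative cell complexes are chains of monomorphisms. Maps out of an object commute with such
colimits of length κ once κ is regular and exceeds the number of its subobjects. -/
lemma hasSmallObjectArgument_of_monomorphisms {B : Type*} [Category* B] [Abelian B]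
    [IsGrothendieckAbelian.{w} B] {ι : Type w} {X Y : ι → B} (f : ∀ i, X i ⟶ Y i)
    [∀ i, Mono (f i)] : MorphismProperty.HasSmallObjectArgument.{w} (MorphismProperty.ofHoms f) := by
  obtain ⟨κ, hκ', hκ⟩ := HasCardinalLT.exists_regular_cardinal_forall.{w}
    (fun i => Subobject (X i))
  have : Fact κ.IsRegular := ⟨hκ'⟩
  have : Nonempty κ.ord.ToType := by simpa using hκ'.ne_zero
  have := WellFoundedLT.toOrderBot κ.ord.ToType
  exact ⟨κ, inferInstance, inferInstance,
    { preservesColimit {X₁ X₂ X Y} i hi f hf := by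
        let hf' : (MorphismProperty.monomorphisms B).TransfiniteCompositionOfShape κ.ord.ToType f :=
          { toTransfiniteCompositionOfShape := hf.toTransfiniteCompositionOfShape
            map_mem j hj := by
              have := (hf.attachCells j hj).pushouts_coproducts
              simp only [MorphismProperty.ofHoms_homFamily] at this
              refine (?_ : _ ≤ MorphismProperty.monomorphisms B) _ this
              simp only [MorphismProperty.pushouts_le_iff, MorphismProperty.coproducts_le_iff]
              rintro _ _ _ ⟨i⟩
              exact inferInstanceAs (Mono _) }
        have (j j' : κ.ord.ToType) (φ : j ⟶ j') : Mono (hf'.F.map φ) := hf'.mem_map φ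
        obtain ⟨i⟩ := hi
        exact IsGrothendieckAbelian.preservesColimit_coyoneda_obj_of_mono (Y := hf'.F) (κ := κ) (hκ i) }⟩

lemma exists_shortExact_orthogonal (hS : IsSuspended S) (hS' : IsClosedUnderCoproducts.{w} S)
    {a b : ℤ} (ha : TStructure.t.le a ≤ S) (hb : S ≤ TStructure.t.le b) {ι : Type w}
    (G : ι → CochainComplex A ℤ) [∀ i, (G i).IsKProjective] (hG : ∀ i, S (Q.obj ((G i)⟦(1 : ℤ)⟧)))
    (K : CochainComplex A ℤ) :
    ∃ X : ShortComplex (CochainComplex A ℤ), X.ShortExact ∧ X.X₁ = K ∧ S (Q.obj X.X₃) ∧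
      ∀ (i : ι) (φ : Q.obj (G i) ⟶ Q.obj X.X₂), φ = 0 := by
  -- A map that extends along G → cone(id_G) vanishes in the derived category, since the cone is
  -- acyclic. The cokernel of this inclusion is G[1], whence the shift in `hG`.
  let I := MorphismProperty.ofHoms (fun i => CochainComplex.mappingCone.inr (𝟙 (G i)))
  have (i : ι) : Mono (CochainComplex.mappingCone.inr (𝟙 (G i))) :=
    (shortExact_triangleRotateShortComplex (𝟙 (G i))).mono_f
  have hI' : MorphismProperty.HasSmallObjectArgument.{w} I :=
    hasSmallObjectArgument_of_monomorphisms (fun i => CochainComplex.mappingCone.inr (𝟙 (G i)))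
  obtain ⟨κ, _, _, _⟩ := hI'.exists_cardinal
  have := monoWithCokernelIn_respectsIso hS
  have := monoWithCokernelIn_isMultiplicative hS hS'
  have := monoWithCokernelIn_isStableUnderCobaseChange hS
  have := monoWithCokernelIn_isStableUnderCoproducts hS hS'
  have := monoWithCokernelIn_isStableUnderFilteredColimits hS hS' ha hb
  have hI : I ≤ monoWithCokernelIn S := by
    rintro _ _ _ ⟨i⟩
    exact (monoWithCokernelIn_iff_of_shortExact hS
      (shortExact_triangleRotateShortComplex (𝟙 (G i)))).2 (hG i)
  let p : K ⟶ (⊤_ _) := terminal.from K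
  have h₁ : monoWithCokernelIn S (SmallObject.ιObj I κ p) := by
    have h := SmallObject.transfiniteCompositionsOfShape_ιObj I κ p
    have hle : (MorphismProperty.coproducts.{w} I).pushouts ≤ monoWithCokernelIn S := by
      simpa only [MorphismProperty.pushouts_le_iff, MorphismProperty.coproducts_le_iff] using hI
    exact MorphismProperty.transfiniteCompositionsOfShape_le _ _ _
      (MorphismProperty.transfiniteCompositionsOfShape_monotone _ hle _ h)
  have := h₁.1
  refine ⟨_, shortExact_cokernel (SmallObject.ιObj I κ p), rfl, h₁.2, fun i φ => ?_⟩
  -- K-projectivity represents φ by an actual map of complexes, to which the lifting property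
  -- applies.
  obtain ⟨g, rfl⟩ := Q_map_surjective_of_isKProjective _ _ φ
  have hp := SmallObject.rlp_πObj I κ p _ ⟨i⟩
  have sq : CommSq g (CochainComplex.mappingCone.inr (𝟙 (G i))) (SmallObject.πObj I κ p)
      (terminal.from _) :=
    ⟨terminal.hom_ext _ _⟩
  dsimp
  rw [← sq.fac_left, Functor.map_comp,
    ((isZero_Q_obj_iff _).2 (acyclic_mappingCone_id (G i))).eq_of_src (Q.map sq.lift) 0, comp_zero]

end Cellular

/-! ### From torsion pairs to t-structures -/

section TStructures

variable {C : Type u} [Category.{v} C] [Preadditive C] [HasZeroObject C] [HasShift C ℤ]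
  [∀ n : ℤ, (shiftFunctor C n).Additive] [Pretriangulated C]

/-- The t-structure whose aisle is a suspended subcategory which is part of a torsion pair. -/
def tStructureOfSuspended (S : ObjectProperty C) (hS : IsSuspended S)
    (h : ∀ X : C, ∃ (L Y : C) (_ : S L) (_ : S.rightOrthogonal Y) (f : L ⟶ X) (g : X ⟶ Y)
      (δ : Y ⟶ L⟦(1 : ℤ)⟧), Triangle.mk f g δ ∈ distTriang C) : TStructure C :=
  have := hS.isClosedUnderIsomorphisms
  { le n := S.shift n
    -- The orthogonal of the aisle in degrees ≤ 0 is the class `ge 1`, hence the offset by one.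
    ge n := S.rightOrthogonal.shift (n - 1)
    le_shift n a n' h X hX := (S.shift_shift a n' n h).ge X hX
    ge_shift n a n' h X hX :=
      (S.rightOrthogonal.shift_shift a (n' - 1) (n - 1) (by lia)).ge X hX
    zero' X Y f hX hY := by
      rw [sub_self, ObjectProperty.shift_zero] at hY
      rw [ObjectProperty.shift_zero] at hX
      exact hY f hX
    le_zero_le X hX := by
      rw [ObjectProperty.shift_zero] at hX
      exact hS.shift X 1 (by simp) hX
    ge_one_le Y hY Z f hZ := by
      rw [sub_self, ObjectProperty.shift_zero] at hY
      apply (shiftFunctor C (1 : ℤ)).map_injective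
      rw [Functor.map_zero, ← cancel_mono ((shiftFunctorCompIsoId C (0 - 1 : ℤ) 1 (by simp)).hom.app Y),
        zero_comp]
      exact hY _ (hS.shift Z 1 (by simp) hZ)
    exists_triangle_zero_one X := by
      rw [sub_self, ObjectProperty.shift_zero, ObjectProperty.shift_zero]
      exact h X }

lemma tStructureOfSuspended_le_zero (S : ObjectProperty C) (hS : IsSuspended S)
    (h : ∀ X : C, ∃ (L Y : C) (_ : S L) (_ : S.rightOrthogonal Y) (f : L ⟶ X) (g : X ⟶ Y)
      (δ : Y ⟶ L⟦(1 : ℤ)⟧), Triangle.mk f g δ ∈ distTriang C) :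
    (tStructureOfSuspended S hS h).le 0 = S := by
  have := hS.isClosedUnderIsomorphisms
  exact ObjectProperty.shift_zero S ℤ

lemma distinguished_of_iso_obj₂ {X₁ X₂ X₂' X₃ : C} {f : X₁ ⟶ X₂} {g : X₂ ⟶ X₃}
    {δ : X₃ ⟶ X₁⟦(1 : ℤ)⟧} (h : Triangle.mk f g δ ∈ distTriang C) (e : X₂ ≅ X₂') :
    Triangle.mk (f ≫ e.hom) (e.inv ≫ g) δ ∈ distTriang C :=
  isomorphic_distinguished _ h _ (Triangle.isoMk _ _ (Iso.refl X₁) e.symm (Iso.refl X₃)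
    ((Category.assoc _ _ _).trans ((f ≫= e.hom_inv_id).trans
      ((Category.comp_id f).trans (Category.id_comp f).symm)))
    (Category.comp_id _)
    (((δ ≫= (shiftFunctor C (1 : ℤ)).map_id X₁).trans (Category.comp_id δ)).trans
      (Category.id_comp δ).symm))

/-- This turns a direct sum of generators into an intersection of co-aisles. -/
lemma shiftedOrthogonal_biprod_iff (Y X₁ X₂ : C) [HasBinaryBiproducts C] :
    shiftedOrthogonal Y (X₁ ⊞ X₂) ↔ shiftedOrthogonal Y X₁ ∧ shiftedOrthogonal Y X₂ := by
  refine ⟨fun h => ⟨fun k hk f => ?_, fun k hk f => ?_⟩, fun h =>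
    (isSuspended_shiftedOrthogonal Y).extension _ (binaryBiproductTriangle_distinguished X₁ X₂)
      h.1 h.2⟩
  · have : (biprod.inl : X₁ ⟶ X₁ ⊞ X₂)⟦k⟧' ≫ biprod.fst⟦k⟧' ≫ f = f := by
      rw [← Category.assoc, ← Functor.map_comp, biprod.inl_fst]
      simp
    rw [← this, h k hk (biprod.fst⟦k⟧' ≫ f), comp_zero]
  · have : (biprod.inr : X₂ ⟶ X₁ ⊞ X₂)⟦k⟧' ≫ biprod.snd⟦k⟧' ≫ f = f := by
      rw [← Category.assoc, ← Functor.map_comp, biprod.inr_snd]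
      simp
    rw [← this, h k hk (biprod.snd⟦k⟧' ≫ f), comp_zero]

lemma ge_zero_iff (𝒯 : TStructure C) (Y : C) :
    𝒯.ge 0 Y ↔ (𝒯.le 0).rightOrthogonal (Y⟦(-1 : ℤ)⟧) := by
  rw [𝒯.ge_iff_isGE, ← 𝒯.isGE_shift_iff Y 0 (-1) 1 (by lia), 𝒯.isGE_iff_orthogonal 0 1 (by lia)]
  exact ⟨fun h X f hX => h X f ⟨hX⟩, fun h X f hX => h f hX.le⟩

lemma ge_zero_iff_of_isGeneratedBy {𝒯 : TStructure C} {E : C} (h : IsGeneratedBy.{w} 𝒯 E)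
    (Y : C) : 𝒯.ge 0 Y ↔ shiftedOrthogonal (Y⟦(-1 : ℤ)⟧) E := by
  rw [ge_zero_iff, show 𝒯.le 0 = susp.{w} E from h, rightOrthogonal_susp_iff]
  rfl

lemma isSuspended_le (𝒯 : TStructure C) (n : ℤ) : IsSuspended (𝒯.le n) where
  of_iso _ _ e hX := (𝒯.le n).prop_of_iso e hX
  extension Δ hΔ h₁ h₃ := (𝒯.isLE₂ Δ hΔ n ⟨h₁⟩ ⟨h₃⟩).le
  shift X k hk hX := 𝒯.le_monotone (by lia : n - k ≤ n) _ (𝒯.le_shift n k (n - k) (by lia) X hX)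

lemma isClosedUnderCoproducts_le (𝒯 : TStructure C) (n : ℤ) :
    IsClosedUnderCoproducts.{w} (𝒯.le n) := fun J X c hc hX => by
  rw [𝒯.le_iff_isLE, 𝒯.isLE_iff_orthogonal n (n + 1) rfl]
  intro Y f hY
  refine Cofan.IsColimit.hom_ext hc _ _ (fun j => ?_)
  rw [comp_zero]
  have : 𝒯.IsLE (X j) n := ⟨hX j⟩
  exact 𝒯.zero _ n (n + 1)

end TStructures

/-! ### Existence of generated t-structures -/

section Generation

variable {A : Type u} [Category.{v} A] [Abelian A] [HasDerivedCategory.{t} A]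
  [IsGrothendieckAbelian.{w} A] {S : ObjectProperty (DerivedCategory A)}

open DerivedCategory

theorem exists_triangle_orthogonal (hS : IsSuspended S) (hS' : IsClosedUnderCoproducts.{w} S)
    {a b : ℤ} (ha : TStructure.t.le a ≤ S) (hb : S ≤ TStructure.t.le b) {ι : Type w}
    (G : ι → CochainComplex A ℤ) [∀ i, (G i).IsKProjective] (hG : ∀ i, S (Q.obj (G i)))
    (X : DerivedCategory A) :
    ∃ (L Y : DerivedCategory A) (_ : S L) (_ : ∀ i (φ : Q.obj (G i) ⟶ Y), φ = 0) (f : L ⟶ X)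
      (g : X ⟶ Y) (δ : Y ⟶ L⟦(1 : ℤ)⟧), Triangle.mk f g δ ∈ distTriang (DerivedCategory A) := by
  -- The cellular embedding is applied to the objects Z with Z[-1] in S: rotating its triangle back
  -- puts the cokernel, shifted by -1, in the aisle position.
  have ha' : TStructure.t.le (a - 1) ≤ S.shift (-1 : ℤ) := fun Z hZ =>
    ha _ (TStructure.t.le_shift (a - 1) (-1) a (by lia) Z hZ)
  have hb' : S.shift (-1 : ℤ) ≤ TStructure.t.le (b - 1) := by
    rw [← TStructure.t.shift_le (-1) b (b - 1) (by lia)]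
    exact fun Z hZ => hb _ hZ
  obtain ⟨Z, hZ, hZ₁, hZ₃, hZ₂⟩ := exists_shortExact_orthogonal (hS.shiftProperty (-1))
    (hS'.shiftProperty (-1)) ha' hb' G (fun i => hS.of_iso
      ((shiftFunctorCompIsoId _ (1 : ℤ) (-1) (by simp)).symm.app (Q.obj (G i)) ≪≫
        (shiftFunctor _ (-1 : ℤ)).mapIso ((Q.commShiftIso (1 : ℤ)).symm.app (G i))) (hG i))
          (Q.objPreimage X)
  let e : Q.obj Z.X₁ ≅ X := Q.mapIso (eqToIso hZ₁) ≪≫ Q.objObjPreimageIso X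
  have hT := inv_rot_of_distTriang _ (triangleOfSES_distinguished hZ)
  exact ⟨_, _, hZ₃, hZ₂, _, _, _, distinguished_of_iso_obj₂ hT e⟩

/-- The objects obtained from complexes of projective objects generate t-structures. -/
theorem exists_isGeneratedBy_biprod {X₁ X₂ : DerivedCategory A} (K₁ K₂ : CochainComplex A ℤ)
    [K₁.IsKProjective] [K₂.IsKProjective] (e₁ : Q.obj K₁ ≅ X₁) (e₂ : Q.obj K₂ ≅ X₂) {a b : ℤ}
    (ha : TStructure.t.le a ≤ susp.{w} (X₁ ⊞ X₂)) (hb : TStructure.t.le b (X₁ ⊞ X₂)) :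
    ∃ 𝒮 : TStructure (DerivedCategory A), IsGeneratedBy.{w} 𝒮 (X₁ ⊞ X₂) := by
  have hS := isSuspended_susp.{w} (X₁ ⊞ X₂)
  have hS' := isClosedUnderCoproducts_susp.{w} (X₁ ⊞ X₂)
  have := derivedCategory_hasCoproductsOfShape A (ULift.{w} ℕ)
  have h₁ : susp.{w} (X₁ ⊞ X₂) X₁ :=
    hS.retract hS' ⟨biprod.inl, biprod.fst, by simp⟩ (susp_self _)
  have h₂ : susp.{w} (X₁ ⊞ X₂) X₂ :=
    hS.retract hS' ⟨biprod.inr, biprod.snd, by simp⟩ (susp_self _)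
  let ε₁ (k : ℕ) : Q.obj (K₁⟦(k : ℤ)⟧) ≅ X₁⟦(k : ℤ)⟧ :=
    (Q.commShiftIso (k : ℤ)).app K₁ ≪≫ (shiftFunctor _ (k : ℤ)).mapIso e₁
  let ε₂ (k : ℕ) : Q.obj (K₂⟦(k : ℤ)⟧) ≅ X₂⟦(k : ℤ)⟧ :=
    (Q.commShiftIso (k : ℤ)).app K₂ ≪≫ (shiftFunctor _ (k : ℤ)).mapIso e₂
  let G : ULift.{w} (ℕ ⊕ ℕ) → CochainComplex A ℤ := fun x =>
    match x with
    | ⟨Sum.inl k⟩ => K₁⟦(k : ℤ)⟧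
    | ⟨Sum.inr k⟩ => K₂⟦(k : ℤ)⟧
  have hG' (x : ULift.{w} (ℕ ⊕ ℕ)) : (G x).IsKProjective := by
    obtain ⟨k | k⟩ := x
    · exact inferInstanceAs (K₁⟦(k : ℤ)⟧).IsKProjective
    · exact inferInstanceAs (K₂⟦(k : ℤ)⟧).IsKProjective
  have hG (x : ULift.{w} (ℕ ⊕ ℕ)) : susp.{w} (X₁ ⊞ X₂) (Q.obj (G x)) := by
    obtain ⟨k | k⟩ := x
    · exact hS.of_iso (ε₁ k).symm (hS.shift _ k (by lia) h₁)
    · exact hS.of_iso (ε₂ k).symm (hS.shift _ k (by lia) h₂)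
  refine ⟨tStructureOfSuspended _ hS (fun X => ?_), tStructureOfSuspended_le_zero _ _ _⟩
  obtain ⟨L, Y, hL, hY, f, g, δ, hT⟩ := exists_triangle_orthogonal hS hS' ha
    (susp_le (isSuspended_le _ b) (isClosedUnderCoproducts_le _ b) hb) G hG X
  refine ⟨L, Y, hL, ?_, f, g, δ, hT⟩
  rw [rightOrthogonal_susp_iff]
  refine (shiftedOrthogonal_biprod_iff Y X₁ X₂).2 ⟨fun k hk φ => ?_, fun k hk φ => ?_⟩
  · obtain ⟨k, rfl⟩ := Int.eq_ofNat_of_zero_le hk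
    rw [← cancel_epi (ε₁ k).hom, comp_zero]
    exact hY ⟨Sum.inl k⟩ _
  · obtain ⟨k, rfl⟩ := Int.eq_ofNat_of_zero_le hk
    rw [← cancel_epi (ε₂ k).hom, comp_zero]
    exact hY ⟨Sum.inr k⟩ _

end Generation

/-! ### The generators R[-i] ⊕ T -/

section Tilting

variable {R : Type u} [Ring R] [HasDerivedCategory.{t} (RMod R)]

open DerivedCategory

lemma exists_isKProjective_iso_stalk (M : RMod R) :
    ∃ K : CochainComplex (RMod R) ℤ, K.IsKProjective ∧ Nonempty (Q.obj K ≅ stalk M) := by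
  let P := ProjectiveResolution.of M
  exact ⟨P.cochainComplex, CochainComplex.isKProjective_of_projective _ 0,
    ⟨singleIsoOfQuasiIso P.π'⟩⟩

lemma IsSuspended.le_of_shift_regular {S : ObjectProperty (DerivedCategory (RMod R))}
    (hS : IsSuspended S) (hS' : IsClosedUnderCoproducts.{u} S) {i : ℤ}
    (h : S ((stalk (regular R))⟦-i⟧)) : TStructure.t.le i ≤ S := fun X hX => by
  have : (X⟦i⟧).IsLE 0 := ⟨TStructure.t.le_shift i i 0 (by lia) X hX⟩
  exact hS.of_iso ((shiftFunctorCompIsoId _ i (-i) (by lia)).app X)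
    ((hS.shiftProperty (-i)).of_isLE_zero (hS'.shiftProperty (-i)) h (X⟦i⟧))

lemma stalk_shift_le (M : RMod R) (i : ℤ) : TStructure.t.le i ((stalk M)⟦-i⟧) :=
  TStructure.t.le_shift 0 (-i) i (by lia) _ (TStructure.t.le_of_isLE _ 0)

/-- The class of objects orthogonal to Y[-1] with all their nonnegative shifts is suspended and
closed under coproducts. Once it contains R[-i] it contains 𝒟^{≤ i}, which forces Y[-1] into 𝒟^{≥
i+1}. -/
lemma shiftedOrthogonal_regular_iff (Y : DerivedCategory (RMod R)) (i : ℤ) :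
    shiftedOrthogonal (Y⟦(-1 : ℤ)⟧) ((stalk (regular R))⟦-i⟧) ↔ TStructure.t.ge i Y := by
  rw [TStructure.t.ge_iff_isGE, ← TStructure.t.isGE_shift_iff Y i (-1) (i + 1) (by lia)]
  constructor
  · intro h
    rw [TStructure.t.isGE_iff_orthogonal i (i + 1) rfl]
    intro X f hX
    have := (isSuspended_shiftedOrthogonal (Y⟦(-1 : ℤ)⟧)).le_of_shift_regular
      (isClosedUnderCoproducts_shiftedOrthogonal _) h X hX.le
    rw [← cancel_epi ((shiftFunctorZero _ ℤ).hom.app X), comp_zero]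
    exact this 0 le_rfl _
  · intro h k hk f
    have : TStructure.t.IsLE (((stalk (regular R))⟦-i⟧)⟦k⟧) i :=
      ⟨(isSuspended_le _ i).shift _ k hk (stalk_shift_le _ i)⟩
    exact TStructure.t.zero f i (i + 1)

/-- The object `R[-i] ⊕ M` generates a t-structure for any module `M`. -/
theorem exists_isGeneratedBy_regular_biprod (M : RMod R) (i : ℤ) :
    ∃ 𝒮 : TStructure (DerivedCategory (RMod R)),
      IsGeneratedBy.{u} 𝒮 ((stalk (regular R))⟦-i⟧ ⊞ stalk M) := by
  obtain ⟨K₁, h₁, ⟨e₁⟩⟩ := exists_isKProjective_iso_stalk (regular R)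
  obtain ⟨K₂, h₂, ⟨e₂⟩⟩ := exists_isKProjective_iso_stalk M
  have := derivedCategory_hasCoproductsOfShape (RMod R) (ULift.{u} ℕ)
  -- The summand R[-i] gives the lower bound a = i; since R[-i] and M lie in degrees ≤ i and ≤ 0,
  -- the upper bound is b = max i 0.
  refine exists_isGeneratedBy_biprod (K₁⟦-i⟧) K₂
    ((Q.commShiftIso (-i)).app K₁ ≪≫ (shiftFunctor _ (-i)).mapIso e₁) e₂ (a := i) (b := max i 0)
    ((isSuspended_susp _).le_of_shift_regular (isClosedUnderCoproducts_susp _)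
      ((isSuspended_susp _).retract (isClosedUnderCoproducts_susp _)
        ⟨biprod.inl, biprod.fst, by simp⟩ (susp_self _))) ?_
  exact (isSuspended_le _ _).extension _ (binaryBiproductTriangle_distinguished _ _)
    (TStructure.t.le_monotone (le_max_left i 0) _ (stalk_shift_le _ i))
    (TStructure.t.le_monotone (le_max_right i 0) _ (TStructure.t.le_of_isLE (stalk M) 0))

/-- The coresolution puts R[n] into Susp(T). Adding this summand changes nothing but exhibits 𝒟^{≤
-n} inside the class, the lower bound needed for generation. -/
lemma susp_eq_of_isTilting {n : ℕ} {T : RMod R} (hT : IsTilting n T) :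
    susp.{u} (stalk T) = susp.{u} ((stalk (regular R))⟦-(-n : ℤ)⟧ ⊞ stalk T) := by
  have := derivedCategory_hasCoproductsOfShape (RMod R) (ULift.{u} ℕ)
  refine le_antisymm (susp_le (isSuspended_susp _) (isClosedUnderCoproducts_susp _)
    ((isSuspended_susp _).retract (isClosedUnderCoproducts_susp _)
      ⟨biprod.inr, biprod.snd, by simp⟩ (susp_self _)))
    (susp_le (isSuspended_susp _) (isClosedUnderCoproducts_susp _) ?_)
  refine (isSuspended_susp _).extension _ (binaryBiproductTriangle_distinguished _ _) ?_
    (susp_self _)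
  rw [neg_neg]
  exact (isSuspended_susp _).regular_of_coresolution (isClosedUnderCoproducts_susp _) hT
    (susp_self _)

end Tilting

end TiltingTStructure

end

open TiltingTStructure in
theorem proposition2p4 {R : Type u} [Ring R] [HasDerivedCategory.{w} (RMod R)]
    (n : ℕ) (T : RMod R) (hT : IsTilting n T) :
    (∃ 𝒯 : TStructure (DerivedCategory (RMod R)), IsGeneratedBy.{u} 𝒯 (stalk T)) ∧
    ∀ 𝒯 : TStructure (DerivedCategory (RMod R)), IsGeneratedBy.{u} 𝒯 (stalk T) →
      IsRightFilterable DerivedCategory.TStructure.t 𝒯 ∧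
      ∀ i : ℤ, ∃ 𝒮 : TStructure (DerivedCategory (RMod R)),
        IsGeneratedBy.{u} 𝒮 ((stalk (regular R))⟦-i⟧ ⊞ stalk T) ∧
        𝒮.ge 0 = DerivedCategory.TStructure.t.ge i ⊓ 𝒯.ge 0 := by
  constructor
  · obtain ⟨𝒯, h𝒯⟩ := exists_isGeneratedBy_regular_biprod T (-n)
    exact ⟨𝒯, h𝒯.trans (susp_eq_of_isTilting hT).symm⟩
  · intro 𝒯 h𝒯
    have key (i : ℤ) : ∃ 𝒮 : TStructure (DerivedCategory (RMod R)),
        IsGeneratedBy.{u} 𝒮 ((stalk (regular R))⟦-i⟧ ⊞ stalk T) ∧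
        𝒮.ge 0 = DerivedCategory.TStructure.t.ge i ⊓ 𝒯.ge 0 := by
      obtain ⟨𝒮, h𝒮⟩ := exists_isGeneratedBy_regular_biprod T i
      refine ⟨𝒮, h𝒮, ?_⟩
      ext Y
      rw [ge_zero_iff_of_isGeneratedBy h𝒮, shiftedOrthogonal_biprod_iff,
        shiftedOrthogonal_regular_iff]
      exact and_congr_right (fun _ => (ge_zero_iff_of_isGeneratedBy h𝒯 Y).symm)
    exact ⟨fun i => by
      obtain ⟨𝒮, -, h⟩ := key i
      exact ⟨𝒮, h⟩, key⟩
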